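/- Let $q$ be a prime power. A $q$-matroid $M=(E,r)$ is a finite-dimensional $\mathbb F_q$-vector space $E$ with an integer-valued function $r$ on the lattice $\mathcal L(E)$ of subspaces of $E$ such that $0\le r(A)\le\dim A$, $r(A)\le r(B)$ for $A\le B$, and $r(A+B)+r(A\cap B)\le r(A)+r(B)$. It is nontrivial if $E\ne 0$, and uniform if for some $0\le k\le \dim E$ one has $r(A)=\min\{k,\dim A\}$ for all $A$. An isomorphism of $q$-matroids is a linear isomorphism of the ground spaces that preserves ranks. A subspace $A$ is independent if $r(A)=\dim A$; a circuit is an inclusion-minimal dependent subspace; a subspace is cyclic if it is a (possibly empty) sum of circuits; it is a flat if it is inclusion-maximal among the subspaces of the same rank. For $A\le B\le E$ the minor $M[A,B]$ is the $q$-matroid on $B/A$ with rank function $X/A\mapsto r(X)-r(A)$. The free product $M_1\square M_2$ of $M_1=(E_1,r_1)$ and $M_2=(E_2,r_2)$ is the $q$-matroid on $E_1\oplus E_2$ whose independent spaces are the subspaces $I$ such that $I_1:=\pi_1(I\cap(E_1\oplus 0))$ is independent in $M_1$ and $r_1(E_1)-r_1(I_1)\ge\dim\pi_2(I)-r_2(\pi_2(I))$,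 where $\pi_1,\pi_2$ are the projections. The free product of an empty sequence is the $q$-matroid on the zero space. A $q$-matroid is irreducible if it is not isomorphic to a free product of two nontrivial $q$-matroids. Let $\mathcal D(M)\subseteq\mathcal L(E)$ be the set of all intersections and all sums of sets of cyclic flats of $M$ (the empty intersection being $E$ and the empty sum being $0$). A pinchpoint of $\mathcal D(M)$ is an element of $\mathcal D(M)$ that is comparable to all elements of $\mathcal D(M)$. **Theorem.** Let $M=(E,r)$ be a $q$-matroid. The pinchpoints of $\mathcal D(M)$ form a finite chain $T_0<\dots<T_k$, and the primary factors $M[T_{i-1},T_i]$, $1\le i\le k$, satisfy: 1. $M\cong M[T_0,T_1]\,\square\cdots\square\, M[T_{k-1},T_k]$; 2. each $M[T_{i-1},T_i]$ is nontrivial, and it is uniform or irreducible; 3. no free product of two or more consecutive terms of the sequence $M[T_0,T_1],\dots,M[T_{k-1},T_k]$ is uniform. Moreover, this factorisation is unique: if $M_1,\dots,M_\ell$ are nontrivial $q$-matroids on spaces $E_1,\dots,E_\ell$, each uniform or irreducible, such that no $M_i\square M_{i+1}$ $(1\le i<\ell)$ is uniform, and if $\varphi$ is an isomorphism from $M$ to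 $M_1\square\cdots\square M_\ell$, then $\ell=k$, $\varphi(T_i)=E_1\oplus\cdots\oplus E_i\oplus 0\oplus\cdots\oplus 0$ for $0\le i\le k$, and $M_i\cong M[T_{i-1},T_i]$ for $1\le i\le k$. -/

import Mathlib

universe u v

/-- A `q`-matroid with ground space `E`: an integer-valued rank function on the lattice of
subspaces of `E` that is bounded (by `0` and the dimension), monotone and submodular. -/
@[ext]
structure QMatroid (K : Type v) (E : Type u) [Field K] [AddCommGroup E] [Module K E] where
  rank : Submodule K E → ℕ
  rank_le_finrank : ∀ A, rank A ≤ Module.finrank K A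
  rank_mono : ∀ A B, A ≤ B → rank A ≤ rank B
  rank_submod : ∀ A B, rank (A ⊔ B) + rank (A ⊓ B) ≤ rank A + rank B

namespace QMatroid

section Basic

variable {K : Type v} {E : Type u} [Field K] [AddCommGroup E] [Module K E]

/-- Independent spaces. -/
def Indep (M : QMatroid K E) (A : Submodule K E) : Prop := M.rank A = Module.finrank K A

/-- Circuits: inclusion-minimal dependent spaces. -/
def IsCircuit (M : QMatroid K E) (C : Submodule K E) : Prop := Minimal (fun A => ¬ M.Indep A) C

/-- Cyclic spaces: sums of circuits (the zero space is the empty sum). -/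
def IsCyclic (M : QMatroid K E) (A : Submodule K E) : Prop :=
  ∃ S : Set (Submodule K E), (∀ C ∈ S, M.IsCircuit C) ∧ sSup S = A

/-- Flats: spaces that are inclusion-maximal among the spaces of the same rank. -/
def IsFlat (M : QMatroid K E) (A : Submodule K E) : Prop :=
  Maximal (fun V => M.rank V = M.rank A) A

/-- The collection of cyclic flats. -/
def cyclicFlats (M : QMatroid K E) : Set (Submodule K E) := {A | M.IsCyclic A ∧ M.IsFlat A}

/-- The set `D(M)` of all intersections and all sums of sets of cyclic flats. The empty
intersection is the whole space and the empty sum is the zero space. -/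
def latticeD (M : QMatroid K E) : Set (Submodule K E) :=
  {X | ∃ S ⊆ M.cyclicFlats, sInf S = X} ∪ {X | ∃ S ⊆ M.cyclicFlats, sSup S = X}

/-- Uniform `q`-matroids: the rank function is `A ↦ min k (dim A)` for some `k ≤ dim E`. -/
def IsUniform (M : QMatroid K E) : Prop :=
  ∃ k ≤ Module.finrank K E, ∀ A : Submodule K E, M.rank A = min k (Module.finrank K A)

/-- A linear isomorphism of the ground spaces that preserves the ranks. -/
def IsIsom {F : Type*} [AddCommGroup F] [Module K F] (M : QMatroid K E) (N : QMatroid K F)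
    (τ : E ≃ₗ[K] F) : Prop :=
  ∀ V : Submodule K E, N.rank (V.map τ.toLinearMap) = M.rank V

end Basic

section Constructions

variable {K : Type v} {E : Type u} [Field K] [AddCommGroup E] [Module K E]

/-- The restriction `M|A`. -/
def restrict (M : QMatroid K E) (A : Submodule K E) : QMatroid K A where
  rank T := M.rank (T.map A.subtype)
  rank_le_finrank T := by
    refine (M.rank_le_finrank _).trans (le_of_eq ?_)
    exact (Submodule.equivMapOfInjective A.subtype A.injective_subtype T).finrank_eq.symm
  rank_mono S T h := M.rank_mono _ _ (Submodule.map_mono h)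
  rank_submod S T := by
    rw [Submodule.map_sup, Submodule.map_inf _ A.injective_subtype]
    exact M.rank_submod _ _

variable [FiniteDimensional K E]

theorem rank_le_add (M : QMatroid K E) {A B : Submodule K E} (h : A ≤ B) :
    M.rank B + Module.finrank K A ≤ M.rank A + Module.finrank K B := by
  obtain ⟨C, hC⟩ := exists_isCompl A
  have hsup : A ⊔ (C ⊓ B) = B := by
    rw [← sup_inf_assoc_of_le C h, hC.sup_eq_top, top_inf_eq]
  have hinf : A ⊓ (C ⊓ B) = ⊥ := by rw [← inf_assoc, hC.inf_eq_bot, bot_inf_eq]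
  have h1 := M.rank_submod A (C ⊓ B)
  have h2 := M.rank_le_finrank (C ⊓ B)
  have h3 := Submodule.finrank_sup_add_finrank_inf_eq A (C ⊓ B)
  rw [hsup] at h1 h3
  rw [hinf, finrank_bot] at h3
  omega

theorem finrank_comap_mkQ (A : Submodule K E) (T : Submodule K (E ⧸ A)) :
    Module.finrank K (T.comap A.mkQ) = Module.finrank K T + Module.finrank K A := by
  have h := LinearMap.finrank_range_add_finrank_ker (A.mkQ.domRestrict (T.comap A.mkQ))
  rw [← h, LinearMap.range_domRestrict,
    Submodule.map_comap_eq_of_surjective A.mkQ_surjective]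
  congr 1
  rw [LinearMap.ker_domRestrict, Submodule.ker_mkQ]
  exact (Submodule.comapSubtypeEquivOfLe (Submodule.le_comap_mkQ A T)).finrank_eq

/-- The contraction `M/A`, with `r_{M/A}(T) = r(π⁻¹(T)) - r(A)`; as `A ≤ π⁻¹(T)`, the subtraction
is never truncated. -/
def contract (M : QMatroid K E) (A : Submodule K E) : QMatroid K (E ⧸ A) where
  rank T := M.rank (T.comap A.mkQ) - M.rank A
  rank_le_finrank T := by
    have h1 := M.rank_le_add (Submodule.le_comap_mkQ A T)
    have h2 := finrank_comap_mkQ A T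
    omega
  rank_mono S T h := Nat.sub_le_sub_right (M.rank_mono _ _ (Submodule.comap_mono h)) _
  rank_submod S T := by
    have h1 := M.rank_submod (S.comap A.mkQ) (T.comap A.mkQ)
    have h2 : S.comap A.mkQ ⊔ T.comap A.mkQ = (S ⊔ T).comap A.mkQ := by
      have h := Submodule.comap_map_eq A.mkQ (S.comap A.mkQ ⊔ T.comap A.mkQ)
      rw [Submodule.map_sup, Submodule.map_comap_eq_of_surjective A.mkQ_surjective,
        Submodule.map_comap_eq_of_surjective A.mkQ_surjective, Submodule.ker_mkQ] at h
      rw [h, eq_comm, sup_eq_left]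
      exact (Submodule.le_comap_mkQ A S).trans le_sup_left
    rw [h2, ← Submodule.comap_inf] at h1
    have h3 := M.rank_mono _ _ (Submodule.le_comap_mkQ A S)
    have h4 := M.rank_mono _ _ (Submodule.le_comap_mkQ A T)
    have h5 := M.rank_mono _ _ (Submodule.le_comap_mkQ A (S ⊓ T))
    have h6 := M.rank_mono _ _ (Submodule.le_comap_mkQ A (S ⊔ T))
    omega

/-- The minor `M[A,B]` for `A ≤ B`, on the ground space `B/A`: restrict to `B`, then contract the
copy of `A` inside `B`. -/
def minor (M : QMatroid K E) (A B : Submodule K E) : QMatroid K (B ⧸ A.submoduleOf B) :=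
  (M.restrict B).contract (A.submoduleOf B)

theorem exists_ge_maximal (p : Submodule K E → Prop) {A : Submodule K E} (hA : p A) :
    ∃ B, A ≤ B ∧ Maximal p B := by
  obtain ⟨B, hB, hmax⟩ := (wellFounded_gt (α := Submodule K E)).has_min {B | A ≤ B ∧ p B}
    ⟨A, le_rfl, hA⟩
  refine ⟨B, hB.1, hB.2, fun C hC hBC => ?_⟩
  by_contra hne
  exact hmax C ⟨hB.1.trans hBC, hC⟩ (lt_of_le_not_ge hBC hne)

theorem exists_indep_rank_eq (M : QMatroid K E) (X : Submodule K E) :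
    ∃ I ≤ X, M.Indep I ∧ M.rank I = M.rank X := by
  have hbot : M.Indep ⊥ := by
    have := M.rank_le_finrank ⊥
    rw [finrank_bot] at this
    simp only [Indep, finrank_bot]
    omega
  obtain ⟨I, -, hI⟩ := exists_ge_maximal
    (fun I : Submodule K E => I ≤ X ∧ M.Indep I) (A := ⊥) ⟨bot_le, hbot⟩
  refine ⟨I, hI.prop.1, hI.prop.2, ?_⟩
  obtain ⟨J, hIJ, hJ⟩ := exists_ge_maximal
    (fun J : Submodule K E => I ≤ J ∧ J ≤ X ∧ M.rank J = M.rank I) (A := I)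
    ⟨le_rfl, hI.prop.1, rfl⟩
  suffices hJX : J = X by rw [← hJX, hJ.prop.2.2]
  by_contra hne
  obtain ⟨x, hxX, hxJ⟩ := SetLike.exists_of_lt (lt_of_le_of_ne hJ.prop.2.1 hne)
  set L := Submodule.span K {x} with hL
  have hLX : L ≤ X := by simpa [hL, Submodule.span_le] using hxX
  have hxL : x ∈ L := Submodule.mem_span_singleton_self x
  have hrI : M.rank (I ⊔ L) = M.rank I := by
    by_contra hr
    have h1 := M.rank_mono I (I ⊔ L) le_sup_left
    have h2 := M.rank_le_finrank (I ⊔ L)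
    have h3 := Submodule.finrank_sup_add_finrank_inf_eq I L
    have h4 : Module.finrank K L ≤ 1 :=
      (finrank_span_le_card {x}).trans (by simp)
    have h5 : M.rank I = Module.finrank K I := hI.prop.2
    have h6 : M.Indep (I ⊔ L) := by
      simp only [Indep]
      omega
    have h7 := hI.le_of_ge ⟨sup_le hI.prop.1 hLX, h6⟩ le_sup_left
    exact hxJ (hIJ (h7 (le_sup_right (a := I) hxL)))
  have h1 := M.rank_submod J (I ⊔ L)
  have h2 : J ⊔ (I ⊔ L) = J ⊔ L := by rw [← sup_assoc, sup_eq_left.mpr hIJ]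
  have h3 := M.rank_mono I (J ⊓ (I ⊔ L)) (le_inf hIJ le_sup_left)
  have h4 := M.rank_mono J (J ⊔ L) le_sup_left
  have h5 := hJ.prop.2.2
  rw [h2] at h1
  have h6 := hJ.le_of_ge (y := J ⊔ L)
    ⟨hIJ.trans le_sup_left, sup_le hJ.prop.2.1 hLX, by omega⟩ le_sup_left
  exact hxJ (h6 (le_sup_right (a := J) hxL))

/-- A `q`-matroid is determined by its independent spaces. -/
theorem ext_indep {M N : QMatroid K E} (h : ∀ I, M.Indep I ↔ N.Indep I) : M = N := by
  have key : ∀ (M N : QMatroid K E), (∀ I, M.Indep I ↔ N.Indep I) →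
      ∀ X, M.rank X ≤ N.rank X := by
    intro M N h X
    obtain ⟨I, hIX, hI, hr⟩ := M.exists_indep_rank_eq X
    have h1 : N.rank I = Module.finrank K I := (h I).1 hI
    have h2 : M.rank I = Module.finrank K I := hI
    have h3 := N.rank_mono I X hIX
    omega
  ext X
  exact le_antisymm (key M N h X) (key N M (fun I => (h I).symm) X)

end Constructions

section FreeProduct

variable {K : Type v} {E₁ E₂ : Type u} [Field K] [AddCommGroup E₁] [Module K E₁]
  [AddCommGroup E₂] [Module K E₂] [FiniteDimensional K E₁] [FiniteDimensional K E₂]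

theorem finrank_eq_comap_inl_add_map_snd (X : Submodule K (E₁ × E₂)) :
    Module.finrank K X = Module.finrank K (X.comap (LinearMap.inl K E₁ E₂)) +
      Module.finrank K (X.map (LinearMap.snd K E₁ E₂)) := by
  have h := LinearMap.finrank_range_add_finrank_ker ((LinearMap.snd K E₁ E₂).domRestrict X)
  rw [LinearMap.range_domRestrict] at h
  rw [← h, add_comm]
  congr 1
  let f : X.comap (LinearMap.inl K E₁ E₂) →ₗ[K]
      LinearMap.ker ((LinearMap.snd K E₁ E₂).domRestrict X) :=
    { toFun := fun a => ⟨⟨(a.1, 0), a.2⟩, rfl⟩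
      map_add' := fun a b => by ext <;> simp
      map_smul' := fun c a => by ext <;> simp }
  refine (LinearEquiv.ofBijective f ⟨?_, ?_⟩).finrank_eq.symm
  · intro a b hab
    have := congrArg (fun z => z.1.1.1) hab
    exact Subtype.ext this
  · rintro ⟨⟨⟨a, b⟩, hX⟩, hk⟩
    have hb : b = 0 := hk
    subst hb
    exact ⟨⟨a, hX⟩, rfl⟩

/-- The free product `M₁ □ M₂` on `E₁ ⊕ E₂`. For `X ≤ E₁ ⊕ E₂` the space `π₁(X ∩ ι₁(E₁))` is the
preimage of `X` under the embedding `ι₁`. The rank is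
`r₁(π₁(X ∩ ι₁ E₁)) + r₂(π₂ X) + min (λ₁(π₁(X ∩ ι₁ E₁))) (ν₂(π₂ X))` with the rank-lack
`λ₁(A) = r₁(E₁) - r₁(A)` and the nullity `ν₂(B) = dim B - r₂(B)`. Its independent spaces are
given by `freeProd_indep_iff`; they determine it by `ext_indep`. -/
noncomputable def freeProd (M₁ : QMatroid K E₁) (M₂ : QMatroid K E₂) : QMatroid K (E₁ × E₂) where
  rank X :=
    M₁.rank (X.comap (LinearMap.inl K E₁ E₂)) + M₂.rank (X.map (LinearMap.snd K E₁ E₂)) +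
      min (M₁.rank ⊤ - M₁.rank (X.comap (LinearMap.inl K E₁ E₂)))
        (Module.finrank K (X.map (LinearMap.snd K E₁ E₂)) -
          M₂.rank (X.map (LinearMap.snd K E₁ E₂)))
  rank_le_finrank X := by
    have h1 := M₁.rank_le_finrank (X.comap (LinearMap.inl K E₁ E₂))
    have h2 := M₂.rank_le_finrank (X.map (LinearMap.snd K E₁ E₂))
    have h3 := finrank_eq_comap_inl_add_map_snd X
    omega
  rank_mono X Y h := by
    have h1 := M₁.rank_mono _ _ (Submodule.comap_mono (f := LinearMap.inl K E₁ E₂) h)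
    have h2 := M₂.rank_mono _ _ (Submodule.map_mono (f := LinearMap.snd K E₁ E₂) h)
    have h3 := Submodule.finrank_mono (Submodule.map_mono (f := LinearMap.snd K E₁ E₂) h)
    have h4 := M₁.rank_mono _ ⊤ (le_top : Y.comap (LinearMap.inl K E₁ E₂) ≤ ⊤)
    have h5 := M₂.rank_le_finrank (X.map (LinearMap.snd K E₁ E₂))
    have h6 := M₂.rank_le_finrank (Y.map (LinearMap.snd K E₁ E₂))
    omega
  rank_submod X Y := by
    have ht := fun Z : Submodule K (E₁ × E₂) =>
      M₁.rank_mono _ ⊤ (le_top : Z.comap (LinearMap.inl K E₁ E₂) ≤ ⊤)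
    have hd := fun Z : Submodule K (E₁ × E₂) =>
      M₂.rank_le_finrank (Z.map (LinearMap.snd K E₁ E₂))
    have hf := fun Z : Submodule K (E₁ × E₂) => finrank_eq_comap_inl_add_map_snd Z
    -- submodularity of `r₂ ∘ π₂`
    have s2 := M₂.rank_submod (X.map (LinearMap.snd K E₁ E₂)) (Y.map (LinearMap.snd K E₁ E₂))
    rw [← Submodule.map_sup] at s2
    have s2' := M₂.rank_mono _ _ (Submodule.map_inf_le (LinearMap.snd K E₁ E₂) (p := X) (q := Y))
    -- supermodularity of the nullity of the part in `E₁`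
    have s1 := M₁.rank_submod (X.comap (LinearMap.inl K E₁ E₂)) (Y.comap (LinearMap.inl K E₁ E₂))
    rw [← Submodule.comap_inf] at s1
    have hle : X.comap (LinearMap.inl K E₁ E₂) ⊔ Y.comap (LinearMap.inl K E₁ E₂) ≤
        (X ⊔ Y).comap (LinearMap.inl K E₁ E₂) :=
      sup_le (Submodule.comap_mono le_sup_left) (Submodule.comap_mono le_sup_right)
    have s1' := M₁.rank_le_add hle
    have s1'' := Submodule.finrank_sup_add_finrank_inf_eq (X.comap (LinearMap.inl K E₁ E₂))
      (Y.comap (LinearMap.inl K E₁ E₂))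
    rw [← Submodule.comap_inf] at s1''
    have sE := Submodule.finrank_sup_add_finrank_inf_eq X Y
    -- monotonicity of the rank-lack and the nullity
    have mono1 := fun (Z W : Submodule K (E₁ × E₂)) (h : Z ≤ W) =>
      M₁.rank_mono _ _ (Submodule.comap_mono (f := LinearMap.inl K E₁ E₂) h)
    have mono2 := fun (Z W : Submodule K (E₁ × E₂)) (h : Z ≤ W) =>
      M₂.rank_le_add (Submodule.map_mono (f := LinearMap.snd K E₁ E₂) h)
    have a1 := mono1 (X ⊓ Y) X inf_le_left
    have a2 := mono1 (X ⊓ Y) Y inf_le_right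
    have a3 := mono1 X (X ⊔ Y) le_sup_left
    have a4 := mono1 Y (X ⊔ Y) le_sup_right
    have b1 := mono2 (X ⊓ Y) X inf_le_left
    have b2 := mono2 (X ⊓ Y) Y inf_le_right
    have b3 := mono2 X (X ⊔ Y) le_sup_left
    have b4 := mono2 Y (X ⊔ Y) le_sup_right
    have t1 := ht X
    have t2 := ht Y
    have t3 := ht (X ⊔ Y)
    have t4 := ht (X ⊓ Y)
    have d1 := hd X
    have d2 := hd Y
    have d3 := hd (X ⊔ Y)
    have d4 := hd (X ⊓ Y)
    have f1 := hf X
    have f2 := hf Y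
    have f3 := hf (X ⊔ Y)
    have f4 := hf (X ⊓ Y)
    clear ht hd hf mono1 mono2
    omega

/-- The independent spaces of `M₁ □ M₂` are the spaces `I` such that `π₁(I ∩ ι₁ E₁)` is independent
in `M₁` and `λ₁(π₁(I ∩ ι₁ E₁)) ≥ ν₂(π₂ I)`. -/
theorem freeProd_indep_iff (M₁ : QMatroid K E₁) (M₂ : QMatroid K E₂)
    (I : Submodule K (E₁ × E₂)) :
    (M₁.freeProd M₂).Indep I ↔
      M₁.Indep ((I ⊓ LinearMap.range (LinearMap.inl K E₁ E₂)).map (LinearMap.fst K E₁ E₂)) ∧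
      Module.finrank K (I.map (LinearMap.snd K E₁ E₂)) -
          M₂.rank (I.map (LinearMap.snd K E₁ E₂)) ≤
        M₁.rank ⊤ - M₁.rank
          ((I ⊓ LinearMap.range (LinearMap.inl K E₁ E₂)).map (LinearMap.fst K E₁ E₂)) := by
  have h0 : (I ⊓ LinearMap.range (LinearMap.inl K E₁ E₂)).map (LinearMap.fst K E₁ E₂) =
      I.comap (LinearMap.inl K E₁ E₂) := by
    ext a
    simp only [Submodule.mem_map, Submodule.mem_inf, LinearMap.mem_range, Submodule.mem_comap]
    constructor
    · rintro ⟨x, ⟨hx, y, rfl⟩, rfl⟩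
      exact hx
    · intro h
      exact ⟨_, ⟨h, a, rfl⟩, rfl⟩
  rw [h0]
  have h1 := M₁.rank_le_finrank (I.comap (LinearMap.inl K E₁ E₂))
  have h2 := M₂.rank_le_finrank (I.map (LinearMap.snd K E₁ E₂))
  have h3 := finrank_eq_comap_inl_add_map_snd I
  simp only [Indep, freeProd]
  omega

end FreeProduct

end QMatroid

/-- A `q`-matroid over `K` together with its (finite-dimensional) ground space. -/
structure BundledQMatroid (K : Type v) [Field K] where
  carrier : Type u
  [addCommGroup : AddCommGroup carrier]
  [module : Module K carrier]
  [finiteDimensional : FiniteDimensional K carrier]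
  toQMatroid : QMatroid K carrier

attribute [instance] BundledQMatroid.addCommGroup BundledQMatroid.module
  BundledQMatroid.finiteDimensional

namespace BundledQMatroid

variable {K : Type v} [Field K]

/-- The `q`-matroid on the zero space. -/
def zero : BundledQMatroid.{u} K where
  carrier := PUnit
  toQMatroid :=
    { rank := fun _ => 0
      rank_le_finrank := fun _ => Nat.zero_le _
      rank_mono := fun _ _ _ => le_rfl
      rank_submod := fun _ _ => le_rfl }

/-- The free product of two `q`-matroids. -/
noncomputable def freeProd (A B : BundledQMatroid.{u} K) : BundledQMatroid.{u} K where
  carrier := A.carrier × B.carrier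
  toQMatroid := A.toQMatroid.freeProd B.toQMatroid

/-- The free product `M₁ □ (M₂ □ (⋯ □ Mₖ))` of a sequence; the empty product is the `q`-matroid on
the zero space. -/
noncomputable def listProd : List (BundledQMatroid.{u} K) → BundledQMatroid.{u} K
  | [] => zero
  | [A] => A
  | A :: B :: L => A.freeProd (listProd (B :: L))

/-- The subspace `E₁ ⊕ ⋯ ⊕ Eᵢ ⊕ 0 ⊕ ⋯ ⊕ 0` of the ground space of `M₁ □ ⋯ □ Mₖ`. -/
noncomputable def initialSpace : (L : List (BundledQMatroid.{u} K)) → ℕ → Submodule K (listProd L).carrier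
  | [], _ => ⊥
  | [_], 0 => ⊥
  | [_], _ + 1 => ⊤
  | _ :: _ :: _, 0 => ⊥
  | A :: B :: L, n + 1 => (⊤ : Submodule K A.carrier).prod (initialSpace (B :: L) n)

/-- Two `q`-matroids are isomorphic. -/
def Iso (A B : BundledQMatroid.{u} K) : Prop :=
  ∃ τ : A.carrier ≃ₗ[K] B.carrier, A.toQMatroid.IsIsom B.toQMatroid τ

/-- `A` is irreducible: it is not (isomorphic to) the free product of two `q`-matroids on nonzero
spaces. -/
def IsIrreducible (A : BundledQMatroid.{u} K) : Prop :=
  ∀ B C : BundledQMatroid.{u} K, Nontrivial B.carrier → Nontrivial C.carrier →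
    ¬ A.Iso (B.freeProd C)

end BundledQMatroid

/-- `x` is a pinchpoint of the set `P`, ordered as a subset of `α`: it is an element of `P` that is
comparable to all elements of `P`. -/
def IsPinchpoint {α : Type*} [PartialOrder α] (P : Set α) (x : α) : Prop :=
  x ∈ P ∧ ∀ y ∈ P, x ≤ y ∨ y ≤ x

namespace QMatroid

variable {K : Type v} {E : Type u} [Field K] [AddCommGroup E] [Module K E]

/-- `T₀ < ⋯ < Tₖ` is the primary flag of `M`: the chain of all pinchpoints of `D(M)`. -/
def IsPrimaryFlag (M : QMatroid K E) {k : ℕ} (T : Fin (k + 1) → Submodule K E) : Prop :=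
  StrictMono T ∧ Set.range T = {X | IsPinchpoint M.latticeD X}

/-- The sequence of minors `M[T₀,T₁], …, M[Tₖ₋₁,Tₖ]` of a chain `T₀ ≤ ⋯ ≤ Tₖ` of subspaces. For the
primary flag these are the primary factors of `M`. -/
def flagMinors [FiniteDimensional K E] (M : QMatroid K E) {k : ℕ}
    (T : Fin (k + 1) → Submodule K E) : List (BundledQMatroid.{u} K) :=
  List.ofFn fun i : Fin k =>
    { carrier := T i.succ ⧸ (T i.castSucc).submoduleOf (T i.succ)
      toQMatroid := M.minor (T i.castSucc) (T i.succ) }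

end QMatroid

/-! Write ν = dim - r for the nullity. Every `X` satisfies r(X) ≤ min(r(X + A), r(X ∩ A) + dim X -
dim(X ∩ A)), and equality for all `X` is precisely the rank formula of M[0,A] □ M[A,E]. Hence free
factorisations correspond to chains of free separators: spaces `A` such that each `X` has r(X) = r(X
+ A) or ν(X) = ν(X ∩ A) (`IsMinorEmbedding.freeProd`,
`IsMinorEmbedding.isFreeSeparatorOn_of_freeProd`).

Free separators are the spaces comparable to all cyclic flats (`isFreeSeparator_iff`). A cyclic flat
cannot be enlarged without raising the rank, nor shrunk without lowering the nullity, so the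
condition at X = Z forces comparability. Conversely, each `X` has a cyclic flat that decides which
alternative holds (`exists_cyclicFlat`). Comparability passes to sums and intersections, so the
pinchpoints are the free separators in D(M).

A free separator outside D(M) lies strictly inside a uniform interval between two pinchpoints
(`IsFreeSeparator.exists_isUniformOn`), whereas an interval between free separators with an element
of D(M) in its interior is not uniform (`IsFreeSeparator.not_isUniformOn`). So between consecutive
pinchpoints the minor is uniform or has no inner free separator, that is, is irreducible.
Conversely, the chain of any admissible factorisation consists of exactly the pinchpoints
(`mem_chain_iff_isPinchpoint`), which gives uniqueness.

Factors are realised on complements inside `E` (`IsMinorEmbedding`), so that iterated minors become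
intervals of a single subspace lattice. -/

namespace QMatroid

/-! ### Free separators, cyclic flats and pinchpoints -/

section Separators

variable {K : Type v} {E : Type u} [Field K] [AddCommGroup E] [Module K E]

/-- `A` is a free separator of the interval `[S, T]`: every `X` in the interval has the rank of
`X ⊔ A` or the nullity of `X ⊓ A`. -/
def IsFreeSeparatorOn (M : QMatroid K E) (S T A : Submodule K E) : Prop :=
  ∀ X, S ≤ X → X ≤ T → M.rank X = M.rank (X ⊔ A) ∨
    M.rank X + Module.finrank K ↥(X ⊓ A) = M.rank (X ⊓ A) + Module.finrank K X

/-- `A` is a free separator of `M`. -/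
def IsFreeSeparator (M : QMatroid K E) (A : Submodule K E) : Prop := M.IsFreeSeparatorOn ⊥ ⊤ A

/-- The minor `M[S, T]` is uniform: every space in `[S, T]` has the rank of `T` or the nullity
of `S`. -/
def IsUniformOn (M : QMatroid K E) (S T : Submodule K E) : Prop :=
  ∀ X, S ≤ X → X ≤ T → M.rank X = M.rank T ∨
    M.rank X + Module.finrank K S = M.rank S + Module.finrank K X

variable {M : QMatroid K E} {S T A X Z : Submodule K E}

theorem IsFreeSeparator.isFreeSeparatorOn (h : M.IsFreeSeparator A) (S T : Submodule K E) :
    M.IsFreeSeparatorOn S T A := fun X _ _ => h X bot_le le_top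

theorem cyclicFlats_subset_latticeD : M.cyclicFlats ⊆ M.latticeD :=
  fun Z hZ => Or.inl ⟨{Z}, by simpa using hZ, sInf_singleton⟩

theorem bot_mem_latticeD : ⊥ ∈ M.latticeD := Or.inr ⟨∅, Set.empty_subset _, sSup_empty⟩

theorem top_mem_latticeD : ⊤ ∈ M.latticeD := Or.inl ⟨∅, Set.empty_subset _, sInf_empty⟩

/-- An interval all of whose elements are free separators is uniform. -/
theorem isUniformOn_of_forall (hST : S ≤ T)
    (h : ∀ A, S ≤ A → A ≤ T → M.IsFreeSeparatorOn S T A) : M.IsUniformOn S T := by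
  intro X hSX hXT
  -- `S ⊔ C ⊓ T` is a complement of `X` in `[S, T]`; its separator condition at `X` is the
  -- uniformity condition at `X`.
  obtain ⟨C, hC⟩ := exists_isCompl X
  have h1 : X ⊔ (S ⊔ C ⊓ T) = T := by
    rw [← sup_assoc, sup_eq_left.2 hSX, ← sup_inf_assoc_of_le C hXT, hC.sup_eq_top, top_inf_eq]
  have h2 : X ⊓ (S ⊔ C ⊓ T) = S := by
    rw [inf_comm, sup_inf_assoc_of_le _ hSX, inf_right_comm, inf_comm C X, hC.inf_eq_bot,
      bot_inf_eq, sup_bot_eq]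
  have h3 := h (S ⊔ C ⊓ T) le_sup_left (sup_le hST inf_le_right) X hSX hXT
  rwa [h1, h2] at h3

variable [FiniteDimensional K E]

theorem Indep.mono {B : Submodule K E} (hB : M.Indep B) (h : A ≤ B) :
    M.Indep A := by
  have h1 := M.rank_le_add h
  have h2 := M.rank_le_finrank A
  unfold Indep at *
  omega

theorem exists_le_minimal (p : Submodule K E → Prop) {A : Submodule K E} (hA : p A) :
    ∃ B, B ≤ A ∧ Minimal p B := by
  obtain ⟨B, hB, hmin⟩ := (wellFounded_lt (α := Submodule K E)).has_min {B | B ≤ A ∧ p B}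
    ⟨A, le_rfl, hA⟩
  refine ⟨B, hB.1, hB.2, fun C hC hBC => ?_⟩
  by_contra hne
  exact hmin C ⟨hBC.trans hB.1, hC⟩ (lt_of_le_not_ge hBC hne)

/-- A cyclic space has no proper subspace of the same nullity. -/
theorem IsCyclic.le_of_nullity_eq {Y : Submodule K E} (hZ : M.IsCyclic Z)
    (hYZ : Y ≤ Z)
    (h : M.rank Z + Module.finrank K Y = M.rank Y + Module.finrank K Z) : Z ≤ Y := by
  obtain ⟨S, hS, rfl⟩ := hZ
  refine sSup_le fun C hC => ?_
  have hCZ : C ≤ sSup S := le_sSup hC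
  -- Nullity is supermodular and that of `Y ⊔ C` is at most that of `Y`, so `Y ⊓ C` has at least the
  -- positive nullity of `C`; minimality of `C` then puts it inside `Y`.
  have h1 := M.rank_submod Y C
  have h2 := Submodule.finrank_sup_add_finrank_inf_eq Y C
  have h3 := M.rank_le_add (sup_le hYZ hCZ)
  have h4 := M.rank_le_finrank C
  have h5 : M.rank C ≠ Module.finrank K C := (hS C hC).prop
  have h6 : ¬ M.Indep (Y ⊓ C) := by
    unfold Indep
    omega
  exact ((hS C hC).le_of_le h6 inf_le_right).trans inf_le_left

/-- A space without proper subspaces of the same nullity is cyclic. -/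
theorem isCyclic_of_forall_lt
    (h : ∀ H < Z, M.rank Z + Module.finrank K H ≠ M.rank H + Module.finrank K Z) :
    M.IsCyclic Z := by
  refine ⟨{C | C ≤ Z ∧ M.IsCircuit C}, fun C hC => hC.2, ?_⟩
  set W := sSup {C | C ≤ Z ∧ M.IsCircuit C} with hW
  have hWZ : W ≤ Z := sSup_le fun C hC => hC.1
  by_contra hne
  -- `H` is a hyperplane of `Z` containing all circuits of `Z`. The nullity drops from `Z` to `H`,
  -- so the rank does not. A basis `I` of `H` plus a line outside `H` is then dependent, and its
  -- circuit lies in `(I ⊔ L) ⊓ H = I`.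
  obtain ⟨H, hWH, hH⟩ := exists_ge_maximal (fun H : Submodule K E => H < Z)
    (lt_of_le_of_ne hWZ hne)
  obtain ⟨x, hxZ, hxH⟩ := SetLike.exists_of_lt hH.prop
  set L := Submodule.span K {x} with hL
  have hxL : x ∈ L := Submodule.mem_span_singleton_self x
  have hLZ : L ≤ Z := by simpa [hL, Submodule.span_le] using hxZ
  have hx0 : x ≠ 0 := fun h0 => hxH (h0 ▸ H.zero_mem)
  have hLd : Module.finrank K L = 1 := finrank_span_singleton hx0
  have hHL : H ⊓ L = ⊥ := by
    rw [eq_bot_iff]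
    rintro y ⟨hyH, hyL⟩
    obtain ⟨c, rfl⟩ := Submodule.mem_span_singleton.1 hyL
    by_cases hc : c = 0
    · simp [hc]
    · exact absurd ((Submodule.smul_mem_iff H hc).1 hyH) hxH
  have hsup : H ⊔ L = Z := by
    by_contra hlt
    exact hxH (hH.le_of_ge (lt_of_le_of_ne (sup_le hH.prop.le hLZ) hlt) le_sup_left
      (le_sup_right (a := H) hxL))
  have hdim := Submodule.finrank_sup_add_finrank_inf_eq H L
  rw [hsup, hHL, finrank_bot] at hdim
  have h1 := h H hH.prop
  have h2 := M.rank_le_add hH.prop.le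
  have h3 := M.rank_mono _ _ hH.prop.le
  obtain ⟨I, hIH, hI, hIr⟩ := M.exists_indep_rank_eq H
  have hIL : I ⊓ L = ⊥ := eq_bot_iff.2 ((inf_le_inf_right L hIH).trans hHL.le)
  have hdI := Submodule.finrank_sup_add_finrank_inf_eq I L
  rw [hIL, finrank_bot] at hdI
  have hdep : ¬ M.Indep (I ⊔ L) := by
    have h4 := M.rank_mono (I ⊔ L) Z (sup_le (hIH.trans hH.prop.le) hLZ)
    unfold Indep at *
    omega
  obtain ⟨C, hC, hCc⟩ := exists_le_minimal (fun A => ¬ M.Indep A) hdep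
  have hCZ : C ≤ Z := hC.trans (sup_le (hIH.trans hH.prop.le) hLZ)
  have hCH : C ≤ H := (le_sSup (show C ∈ {C | C ≤ Z ∧ M.IsCircuit C} from ⟨hCZ, hCc⟩)).trans hWH
  have hCI : C ≤ I := by
    have h5 : (I ⊔ L) ⊓ H = I := by
      rw [sup_inf_assoc_of_le L hIH, inf_comm, hHL, sup_bot_eq]
    exact h5 ▸ le_inf hC hCH
  exact hCc.prop (hI.mono hCI)

/-- Every space `X` is governed by a cyclic flat `Z`: joining a subspace of `Z` to `X` does not
increase the rank, and intersecting `X` with a space above `Z` does not decrease the nullity. -/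
theorem exists_cyclicFlat (M : QMatroid K E) (X : Submodule K E) :
    ∃ Z ∈ M.cyclicFlats, (∀ A ≤ Z, M.rank X = M.rank (X ⊔ A)) ∧
      ∀ A, Z ≤ A →
        M.rank X + Module.finrank K ↥(X ⊓ A) = M.rank (X ⊓ A) + Module.finrank K X := by
  -- `F` is the closure of `X`, and `Z` below is the cyclic core of `F`: a minimal subspace with the
  -- nullity of `F`.
  obtain ⟨F, hXF, hF⟩ := exists_ge_maximal (fun V => M.rank V = M.rank X) (A := X) rfl
  obtain ⟨Z, hZF, hZ⟩ := exists_le_minimal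
    (fun V => V ≤ F ∧ M.rank F + Module.finrank K V = M.rank V + Module.finrank K F) (A := F)
    ⟨le_rfl, rfl⟩
  have hFX := hF.prop
  have hZn := hZ.prop.2
  refine ⟨Z, ⟨isCyclic_of_forall_lt fun H hH hn => ?_, rfl, fun V hV hZV => ?_⟩, fun A hA => ?_,
    fun A hA => ?_⟩
  · exact hH.not_ge (hZ.le_of_le ⟨hH.le.trans hZF, by omega⟩ hH.le)
  · have h1 := M.rank_submod F V
    have h2 := M.rank_mono Z (F ⊓ V) (le_inf hZF hZV)
    have h3 := M.rank_mono F (F ⊔ V) le_sup_left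
    have hVF : V ≤ F := le_sup_right.trans (hF.le_of_ge (y := F ⊔ V) (by omega) le_sup_left)
    have h4 := M.rank_le_add hVF
    have h5 : Module.finrank K V ≤ Module.finrank K Z := by omega
    exact (Submodule.eq_of_le_of_finrank_le hZV h5).ge
  · have h1 := M.rank_mono X (X ⊔ A) le_sup_left
    have h2 := M.rank_mono (X ⊔ A) F (sup_le hXF (hA.trans hZF))
    omega
  -- Supermodularity of the nullity: `X ⊔ Z` has nullity at most that of `F`, which equals that of
  -- `Z`, so `X ⊓ Z` has the nullity of `X`.
  · have h1 := M.rank_submod X Z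
    have h2 := Submodule.finrank_sup_add_finrank_inf_eq X Z
    have h3 := M.rank_le_add (sup_le hXF hZF)
    have h4 := M.rank_le_add (inf_le_left : X ⊓ A ≤ X)
    have h5 := M.rank_le_add (inf_le_inf_left X hA)
    omega

/-- At `X = Z` the first alternative gives `A ≤ Z` by flatness, the second gives `Z ≤ A` by
cyclicity. -/
theorem IsFreeSeparatorOn.comparable (h : M.IsFreeSeparatorOn S T A) (hZ : Z ∈ M.cyclicFlats)
    (hSZ : S ≤ Z) (hZT : Z ≤ T) : A ≤ Z ∨ Z ≤ A := by
  rcases h Z hSZ hZT with h | h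
  · exact Or.inl (le_sup_right.trans (hZ.2.le_of_ge h.symm le_sup_left))
  · exact Or.inr ((hZ.1.le_of_nullity_eq inf_le_left h).trans inf_le_right)

theorem isFreeSeparator_iff :
    M.IsFreeSeparator A ↔ ∀ Z ∈ M.cyclicFlats, A ≤ Z ∨ Z ≤ A := by
  refine ⟨fun h Z hZ => h.comparable hZ bot_le le_top, fun h X _ _ => ?_⟩
  obtain ⟨Z, hZ, h1, h2⟩ := M.exists_cyclicFlat X
  exact (h Z hZ).imp (h1 A) (h2 A)

/-- If `A` is not below all members of an intersection, it lies above one of them and so above the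
intersection; sums are dual. -/
theorem IsFreeSeparator.comparable_latticeD (h : M.IsFreeSeparator A) (hX : X ∈ M.latticeD) :
    A ≤ X ∨ X ≤ A := by
  rw [isFreeSeparator_iff] at h
  rcases hX with ⟨S, hS, rfl⟩ | ⟨S, hS, rfl⟩
  · by_cases hA : ∀ Z ∈ S, A ≤ Z
    · exact Or.inl (le_sInf hA)
    · push Not at hA
      obtain ⟨Z, hZ, hAZ⟩ := hA
      exact Or.inr ((sInf_le hZ).trans ((h Z (hS hZ)).resolve_left hAZ))
  · by_cases hA : ∀ Z ∈ S, Z ≤ A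
    · exact Or.inr (sSup_le hA)
    · push Not at hA
      obtain ⟨Z, hZ, hAZ⟩ := hA
      exact Or.inl (((h Z (hS hZ)).resolve_right hAZ).trans (le_sSup hZ))

theorem isPinchpoint_iff :
    IsPinchpoint M.latticeD X ↔ X ∈ M.latticeD ∧ M.IsFreeSeparator X :=
  ⟨fun h => ⟨h.1, isFreeSeparator_iff.2 fun Z hZ => h.2 Z (cyclicFlats_subset_latticeD hZ)⟩,
    fun h => ⟨h.1, fun _ hY => h.2.comparable_latticeD hY⟩⟩

theorem isFreeSeparator_bot : M.IsFreeSeparator ⊥ :=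
  isFreeSeparator_iff.2 fun _ _ => Or.inl bot_le

theorem isFreeSeparator_top : M.IsFreeSeparator ⊤ :=
  isFreeSeparator_iff.2 fun _ _ => Or.inr le_top

/-- Each cyclic flat lies below `S`, above `T`, or in `[S, T]`, where the relative condition
applies. -/
theorem IsFreeSeparatorOn.isFreeSeparator (hA : M.IsFreeSeparatorOn S T A) (hSA : S ≤ A)
    (hAT : A ≤ T) (hS : M.IsFreeSeparator S) (hT : M.IsFreeSeparator T) :
    M.IsFreeSeparator A := by
  rw [isFreeSeparator_iff] at *
  intro Z hZ
  rcases hS Z hZ with h1 | h1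
  · rcases hT Z hZ with h2 | h2
    · exact Or.inl (hAT.trans h2)
    · exact hA.comparable hZ h1 h2
  · exact Or.inr (h1.trans hSA)

theorem IsUniformOn.mono {S' T' : Submodule K E} (h : M.IsUniformOn S T) (hS : S ≤ S')
    (hT : T' ≤ T) : M.IsUniformOn S' T' := by
  intro X h1 h2
  have a1 := M.rank_mono _ _ h2
  have a2 := M.rank_mono _ _ hT
  have a3 := M.rank_le_add h1
  have a4 := M.rank_le_add hS
  rcases h X (hS.trans h1) (h2.trans hT) with h3 | h3 <;> omega

/-- A free separator outside `D(M)` lies strictly between two pinchpoints that bound a uniform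
interval. -/
theorem IsFreeSeparator.exists_isUniformOn (hA : M.IsFreeSeparator A) (hAD : A ∉ M.latticeD) :
    ∃ P Q, IsPinchpoint M.latticeD P ∧ IsPinchpoint M.latticeD Q ∧ P < A ∧ A < Q ∧
      M.IsUniformOn P Q := by
  have hc := isFreeSeparator_iff.1 hA
  set P := sSup {Z | Z ∈ M.cyclicFlats ∧ Z ≤ A} with hP
  set Q := sInf {Z | Z ∈ M.cyclicFlats ∧ A ≤ Z} with hQ
  have hPD : P ∈ M.latticeD := Or.inr ⟨_, fun Z hZ => hZ.1, rfl⟩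
  have hQD : Q ∈ M.latticeD := Or.inl ⟨_, fun Z hZ => hZ.1, rfl⟩
  have hPA : P ≤ A := sSup_le fun Z hZ => hZ.2
  have hAQ : A ≤ Q := le_sInf fun Z hZ => hZ.2
  -- Every cyclic flat lies below `P` or above `Q`, hence the whole of `[P, Q]` consists of free
  -- separators.
  have hsep : ∀ B, P ≤ B → B ≤ Q → M.IsFreeSeparator B := fun B hPB hBQ =>
    isFreeSeparator_iff.2 fun Z hZ => (hc Z hZ).imp
      (fun h => hBQ.trans (sInf_le ⟨hZ, h⟩))
      (fun h => le_trans (le_sSup (show Z ∈ {Z | Z ∈ M.cyclicFlats ∧ Z ≤ A} from ⟨hZ, h⟩)) hPB)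
  refine ⟨P, Q, isPinchpoint_iff.2 ⟨hPD, hsep P le_rfl (hPA.trans hAQ)⟩,
    isPinchpoint_iff.2 ⟨hQD, hsep Q (hPA.trans hAQ) le_rfl⟩,
    lt_of_le_of_ne hPA fun h => hAD (h ▸ hPD), lt_of_le_of_ne hAQ fun h => hAD (h ▸ hQD),
    isUniformOn_of_forall (hPA.trans hAQ) fun B h1 h2 => (hsep B h1 h2).isFreeSeparatorOn P Q⟩

/-- An interval between free separators with an element of `D(M)` in its interior is not
uniform. -/
theorem IsFreeSeparator.not_isUniformOn (hS : M.IsFreeSeparator S) (hT : M.IsFreeSeparator T)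
    (hA : A ∈ M.latticeD) (hSA : S < A) (hAT : A < T) : ¬ M.IsUniformOn S T := by
  rw [isFreeSeparator_iff] at hS hT
  -- `A` itself need not be a cyclic flat. If no member of an intersection `A > S` were strictly
  -- below `T`, all would contain `T`, and so would `A`; sums are dual.
  obtain ⟨Z, hZ, hSZ, hZT⟩ : ∃ Z ∈ M.cyclicFlats, S < Z ∧ Z < T := by
    rcases hA with ⟨R, hR, rfl⟩ | ⟨R, hR, rfl⟩
    · by_contra! hno
      refine hAT.not_ge (le_sInf fun Z hZ => ?_)
      have h1 : S < Z := hSA.trans_le (sInf_le hZ)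
      rcases hT Z (hR hZ) with h2 | h2
      · exact h2
      · by_contra h3
        exact hno Z (hR hZ) h1 (lt_of_le_not_ge h2 h3)
    · by_contra! hno
      refine hSA.not_ge (sSup_le fun Z hZ => ?_)
      have h1 : Z < T := (le_sSup hZ).trans_lt hAT
      rcases hS Z (hR hZ) with h2 | h2
      · by_contra h3
        exact hno Z (hR hZ) (lt_of_le_not_ge h2 h3) h1
      · exact h2
  intro hU
  rcases hU Z hSZ.le hZT.le with h | h
  · exact hZT.not_ge (hZ.2.le_of_ge h.symm hZT.le)
  · exact hSZ.not_ge (hZ.1.le_of_nullity_eq hSZ.le h)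

end Separators

end QMatroid

namespace QMatroid

/-! ### Minors realised on complements, and their free products -/

section MinorEmbeddings

variable {K : Type v} {E F F₁ F₂ : Type u} [Field K] [AddCommGroup E] [Module K E]
  [AddCommGroup F] [Module K F] [AddCommGroup F₁] [Module K F₁] [AddCommGroup F₂] [Module K F₂]

/-- `g` embeds the ground space of `N` as a complement of `S` in `T`, in such a way that the
induced isomorphism with `T / S` is an isomorphism between `N` and the minor `M[S, T]`. -/
structure IsMinorEmbedding (M : QMatroid K E) (S T : Submodule K E) (N : QMatroid K F)
    (g : F →ₗ[K] E) : Prop where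
  injective : Function.Injective g
  inf_range : S ⊓ LinearMap.range g = ⊥
  sup_range : S ⊔ LinearMap.range g = T
  rank_sup_map : ∀ X : Submodule K F, M.rank (S ⊔ X.map g) = N.rank X + M.rank S

theorem map_top_prod (f : F₁ × F₂ →ₗ[K] E) (X : Submodule K F₂) :
    ((⊤ : Submodule K F₁).prod X).map f =
      LinearMap.range (f ∘ₗ LinearMap.inl K F₁ F₂) ⊔ X.map (f ∘ₗ LinearMap.inr K F₁ F₂) := by
  rw [LinearMap.prod_eq_sup_map, Submodule.map_sup, ← Submodule.map_comp, ← Submodule.map_comp,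
    Submodule.map_top]

theorem rank_bot (M : QMatroid K E) : M.rank ⊥ = 0 := by
  have h := M.rank_le_finrank ⊥
  rw [finrank_bot] at h
  omega

variable {M : QMatroid K E} {S T A : Submodule K E} {N : QMatroid K F} {N₁ : QMatroid K F₁}
  {N₂ : QMatroid K F₂} {g : F →ₗ[K] E} {g₁ : F₁ →ₗ[K] E} {g₂ : F₂ →ₗ[K] E}

namespace IsMinorEmbedding

theorem le (h : M.IsMinorEmbedding S T N g) : S ≤ T := h.sup_range ▸ le_sup_left

theorem sup_map_le (h : M.IsMinorEmbedding S T N g) (X : Submodule K F) : S ⊔ X.map g ≤ T :=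
  h.sup_range ▸ sup_le_sup_left LinearMap.map_le_range S

theorem sup_map_top (h : M.IsMinorEmbedding S T N g) : S ⊔ (⊤ : Submodule K F).map g = T := by
  rw [Submodule.map_top, h.sup_range]

theorem eq_zero (h : M.IsMinorEmbedding S T N g) {x : F} (hx : g x ∈ S) : x = 0 := by
  have h1 : g x ∈ S ⊓ LinearMap.range g := ⟨hx, x, rfl⟩
  rw [h.inf_range, Submodule.mem_bot] at h1
  exact h.injective (h1.trans (map_zero g).symm)

theorem sup_map_comap (h : M.IsMinorEmbedding S T N g) {X : Submodule K E} (hSX : S ≤ X)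
    (hXT : X ≤ T) : S ⊔ (X.comap g).map g = X := by
  rw [Submodule.map_comap_eq, ← sup_inf_assoc_of_le _ hSX, h.sup_range, inf_eq_right.2 hXT]

theorem finrank_sup_map [FiniteDimensional K E] (h : M.IsMinorEmbedding S T N g)
    (X : Submodule K F) :
    Module.finrank K ↥(S ⊔ X.map g) = Module.finrank K S + Module.finrank K X := by
  have h1 := Submodule.finrank_sup_add_finrank_inf_eq S (X.map g)
  have h2 : S ⊓ X.map g = ⊥ :=
    eq_bot_iff.2 ((inf_le_inf_left S LinearMap.map_le_range).trans h.inf_range.le)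
  have h3 := (Submodule.equivMapOfInjective g h.injective X).finrank_eq
  rw [h2, finrank_bot] at h1
  omega

theorem lt_iff_nontrivial [FiniteDimensional K E] (h : M.IsMinorEmbedding S T N g) :
    S < T ↔ Nontrivial F := by
  constructor
  · intro hST
    by_contra hF
    rw [not_nontrivial_iff_subsingleton] at hF
    have h1 := h.finrank_sup_map ⊤
    rw [h.sup_map_top, Subsingleton.elim (⊤ : Submodule K F) ⊥, finrank_bot] at h1
    have h2 := Submodule.finrank_lt_finrank_of_lt hST
    omega
  · rintro ⟨x, y, hxy⟩
    refine lt_of_le_of_ne h.le fun hST => hxy (sub_eq_zero.1 (h.eq_zero (hST ▸ ?_)))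
    exact h.sup_range ▸ Submodule.mem_sup_right ⟨_, rfl⟩

theorem of_isIsom (h : M.IsMinorEmbedding S T N₁ g₁) {τ : F₁ ≃ₗ[K] F₂}
    (hτ : N₁.IsIsom N₂ τ) : M.IsMinorEmbedding S T N₂ (g₁ ∘ₗ τ.symm.toLinearMap) where
  injective := h.injective.comp τ.symm.injective
  inf_range := by rw [LinearEquiv.range_comp, h.inf_range]
  sup_range := by rw [LinearEquiv.range_comp, h.sup_range]
  rank_sup_map X := by
    rw [Submodule.map_comp, h.rank_sup_map, ← hτ, ← Submodule.map_comp,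
      LinearEquiv.comp_symm, Submodule.map_id]

/-- The minor `M[S, T]` determines the `q`-matroid embedded as such up to isomorphism. -/
theorem exists_isIsom (h₁ : M.IsMinorEmbedding S T N₁ g₁) (h₂ : M.IsMinorEmbedding S T N₂ g₂) :
    ∃ τ : F₁ ≃ₗ[K] F₂, N₁.IsIsom N₂ τ := by
  have inj₁ : Function.Injective (S.mkQ ∘ₗ g₁) := by
    refine (injective_iff_map_eq_zero _).2 fun x hx => h₁.eq_zero ?_
    simpa using hx
  have inj₂ : Function.Injective (S.mkQ ∘ₗ g₂) := by
    refine (injective_iff_map_eq_zero _).2 fun x hx => h₂.eq_zero ?_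
    simpa using hx
  have map_range : ∀ R : Submodule K E, (S ⊔ R).map S.mkQ = R.map S.mkQ := fun R => by
    rw [Submodule.map_sup, Submodule.mkQ_map_self, bot_sup_eq]
  have hr : LinearMap.range (S.mkQ ∘ₗ g₁) = LinearMap.range (S.mkQ ∘ₗ g₂) := by
    rw [LinearMap.range_comp, LinearMap.range_comp, ← map_range, ← map_range (LinearMap.range g₂),
      h₁.sup_range, h₂.sup_range]
  -- Both ground spaces embed in `E ⧸ S` with the same image, that of `T`; `τ` identifies them
  -- through it.
  let τ : F₁ ≃ₗ[K] F₂ := (LinearEquiv.ofInjective _ inj₁).trans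
    ((LinearEquiv.ofEq _ _ hr).trans (LinearEquiv.ofInjective _ inj₂).symm)
  have hτ : ∀ x, S.mkQ (g₂ (τ x)) = S.mkQ (g₁ x) := fun x =>
    congrArg Subtype.val (LinearEquiv.apply_symm_apply (LinearEquiv.ofInjective _ inj₂)
      (LinearEquiv.ofEq _ _ hr (LinearEquiv.ofInjective _ inj₁ x)))
  refine ⟨τ, fun V => ?_⟩
  have hmap : ((V.map τ.toLinearMap).map g₂).map S.mkQ = (V.map g₁).map S.mkQ := by
    rw [← Submodule.map_comp, ← Submodule.map_comp, ← Submodule.map_comp]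
    congr 1
    ext x
    exact hτ x
  have hsup := congrArg (Submodule.comap S.mkQ) hmap
  rw [Submodule.comap_map_mkQ, Submodule.comap_map_mkQ] at hsup
  have e₁ := h₁.rank_sup_map V
  have e₂ := h₂.rank_sup_map (V.map τ.toLinearMap)
  rw [hsup] at e₂
  omega

/-- The value `min k (dim X)` means full rank or nullity zero, with `k` necessarily `N.rank ⊤`; in
`[S, T]` these become the rank of `T` and the nullity of `S`. -/
theorem isUniform_iff [FiniteDimensional K E] [FiniteDimensional K F]
    (h : M.IsMinorEmbedding S T N g) : N.IsUniform ↔ M.IsUniformOn S T := by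
  have eT := h.rank_sup_map ⊤
  rw [h.sup_map_top] at eT
  constructor
  · rintro ⟨k, hk, hN⟩ X hSX hXT
    have e := h.rank_sup_map (X.comap g)
    have d := h.finrank_sup_map (X.comap g)
    rw [h.sup_map_comap hSX hXT] at e d
    rw [hN] at e eT
    rw [finrank_top] at eT
    have hd := Submodule.finrank_le (X.comap g)
    omega
  · intro hU
    have hk := N.rank_le_finrank ⊤
    rw [finrank_top] at hk
    refine ⟨N.rank ⊤, hk, fun X => ?_⟩
    have e := h.rank_sup_map X
    have d := h.finrank_sup_map X
    have b₁ := N.rank_le_finrank X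
    have b₂ := N.rank_mono _ _ (le_top : X ≤ ⊤)
    rcases hU _ le_sup_left (h.sup_map_le X) with h' | h' <;> omega

/-- For the combined embedding `g` of two minors `M[S, A]` and `M[A, T]`, the spaces `S + g(X)` meet
`A` in the part of `X` in the first factor. -/
theorem sup_map_coprod_inf (h₁ : M.IsMinorEmbedding S A N₁ g₁)
    (h₂ : M.IsMinorEmbedding A T N₂ g₂) (X : Submodule K (F₁ × F₂)) :
    (S ⊔ X.map (g₁.coprod g₂)) ⊓ A = S ⊔ (X.comap (LinearMap.inl K F₁ F₂)).map g₁ := by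
  apply le_antisymm
  · rintro y ⟨hy, hyA⟩
    obtain ⟨s, hs, z, ⟨⟨a, b⟩, hab, rfl⟩, rfl⟩ := Submodule.mem_sup.1 hy
    have hg₁ : g₁ a ∈ A := h₁.sup_range ▸ Submodule.mem_sup_right ⟨a, rfl⟩
    have hb : b = 0 := by
      apply h₂.eq_zero
      have := A.sub_mem (A.sub_mem hyA (h₁.le hs)) hg₁
      simpa using this
    subst hb
    refine Submodule.add_mem_sup hs ⟨a, hab, ?_⟩
    simp
  · refine sup_le (le_inf le_sup_left h₁.le) (le_inf ?_ ?_)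
    · refine le_trans ?_ le_sup_right
      rintro _ ⟨a, ha, rfl⟩
      exact ⟨(a, 0), ha, by simp⟩
    · exact le_sup_right.trans (h₁.sup_map_le _)

/-- Modulo `A` only second coordinates survive, since `g₁` maps into `A`. -/
theorem sup_map_coprod_sup (h₁ : M.IsMinorEmbedding S A N₁ g₁)
    (X : Submodule K (F₁ × F₂)) :
    (S ⊔ X.map (g₁.coprod g₂)) ⊔ A = A ⊔ (X.map (LinearMap.snd K F₁ F₂)).map g₂ := by
  have hg₁ : ∀ a, g₁ a ∈ A := fun a => h₁.sup_range ▸ Submodule.mem_sup_right ⟨a, rfl⟩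
  apply le_antisymm
  · refine sup_le (sup_le (h₁.le.trans le_sup_left) ?_) le_sup_left
    rintro _ ⟨⟨a, b⟩, hab, rfl⟩
    rw [LinearMap.coprod_apply]
    exact Submodule.add_mem_sup (hg₁ a) ⟨b, ⟨_, hab, rfl⟩, rfl⟩
  · refine sup_le le_sup_right ?_
    rintro _ ⟨_, ⟨⟨a, b⟩, hab, rfl⟩, rfl⟩
    have h : g₂ b = g₁.coprod g₂ (a, b) + -g₁ a := by simp
    change g₂ b ∈ _
    rw [h]
    exact Submodule.add_mem_sup (Submodule.mem_sup_right ⟨_, hab, rfl⟩) (A.neg_mem (hg₁ a))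

variable [FiniteDimensional K F₁] [FiniteDimensional K F₂]

/-- If `A` is a free separator of `[S, T]`, then `M[S, T]` is the free product of `M[S, A]` and
`M[A, T]`. -/
theorem freeProd [FiniteDimensional K E] (h₁ : M.IsMinorEmbedding S A N₁ g₁)
    (h₂ : M.IsMinorEmbedding A T N₂ g₂)
    (hA : M.IsFreeSeparatorOn S T A) :
    M.IsMinorEmbedding S T (N₁.freeProd N₂) (g₁.coprod g₂) := by
  have hg₁ : ∀ a, g₁ a ∈ A := fun a => h₁.sup_range ▸ Submodule.mem_sup_right ⟨a, rfl⟩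
  have key : ∀ a b, g₁ a + g₂ b ∈ S → a = 0 ∧ b = 0 := by
    intro a b h
    have hb : b = 0 := by
      apply h₂.eq_zero
      have := A.sub_mem (h₁.le h) (hg₁ a)
      simpa using this
    subst hb
    exact ⟨h₁.eq_zero (by simpa using h), rfl⟩
  have inj : Function.Injective (g₁.coprod g₂) := by
    refine (injective_iff_map_eq_zero _).2 ?_
    rintro ⟨a, b⟩ h
    rw [LinearMap.coprod_apply] at h
    obtain ⟨rfl, rfl⟩ := key a b (h ▸ S.zero_mem)
    rfl
  have inf : S ⊓ LinearMap.range (g₁.coprod g₂) = ⊥ := by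
    rw [eq_bot_iff]
    rintro _ ⟨h, ⟨a, b⟩, rfl⟩
    obtain ⟨rfl, rfl⟩ := key a b (by simpa using h)
    simp
  have sup : S ⊔ LinearMap.range (g₁.coprod g₂) = T := by
    rw [LinearMap.range_coprod, ← sup_assoc, h₁.sup_range, h₂.sup_range]
  refine ⟨inj, inf, sup, fun X => ?_⟩
  have hX := hA (S ⊔ X.map (g₁.coprod g₂)) le_sup_left
    (sup ▸ sup_le_sup_left LinearMap.map_le_range S)
  -- `m₁` and `m₂` bound the rank by both options of the `min` in the free product; `hX` says that
  -- one bound is attained.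
  have m₁ := M.rank_mono _ _
    (le_sup_left : S ⊔ X.map (g₁.coprod g₂) ≤ (S ⊔ X.map (g₁.coprod g₂)) ⊔ A)
  have m₂ := M.rank_le_add
    (inf_le_left : (S ⊔ X.map (g₁.coprod g₂)) ⊓ A ≤ S ⊔ X.map (g₁.coprod g₂))
  have d : Module.finrank K ↥(S ⊔ X.map (g₁.coprod g₂)) =
      Module.finrank K S + Module.finrank K X := by
    have e₁ := Submodule.finrank_sup_add_finrank_inf_eq S (X.map (g₁.coprod g₂))
    have e₂ : S ⊓ X.map (g₁.coprod g₂) = ⊥ :=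
      eq_bot_iff.2 ((inf_le_inf_left S LinearMap.map_le_range).trans inf.le)
    have e₃ := (Submodule.equivMapOfInjective _ inj X).finrank_eq
    rw [e₂, finrank_bot] at e₁
    omega
  rw [h₁.sup_map_coprod_inf h₂, h₁.sup_map_coprod_sup] at hX
  rw [h₁.sup_map_coprod_sup] at m₁
  rw [h₁.sup_map_coprod_inf h₂] at m₂
  have r₁ := h₁.rank_sup_map (X.comap (LinearMap.inl K F₁ F₂))
  have r₂ := h₂.rank_sup_map (X.map (LinearMap.snd K F₁ F₂))
  have rA := h₁.rank_sup_map ⊤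
  rw [h₁.sup_map_top] at rA
  have d₁ := h₁.finrank_sup_map (X.comap (LinearMap.inl K F₁ F₂))
  have dX := finrank_eq_comap_inl_add_map_snd X
  have b₁ := N₁.rank_mono _ _ (le_top : X.comap (LinearMap.inl K F₁ F₂) ≤ ⊤)
  have b₂ := N₂.rank_le_finrank (X.map (LinearMap.snd K F₁ F₂))
  simp only [QMatroid.freeProd]
  omega

variable {f : F₁ × F₂ →ₗ[K] E}

/-- A space inside the first factor has zero projection to the second, so the nullity in the `min`
vanishes. -/
theorem fst_of_freeProd (h : M.IsMinorEmbedding S T (N₁.freeProd N₂) f) :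
    M.IsMinorEmbedding S (S ⊔ LinearMap.range (f ∘ₗ LinearMap.inl K F₁ F₂)) N₁
      (f ∘ₗ LinearMap.inl K F₁ F₂) where
  injective := h.injective.comp LinearMap.inl_injective
  inf_range := eq_bot_iff.2
    ((inf_le_inf_left S (LinearMap.range_comp_le_range _ _)).trans h.inf_range.le)
  sup_range := rfl
  rank_sup_map X := by
    rw [Submodule.map_comp, h.rank_sup_map]
    simp only [QMatroid.freeProd]
    rw [Submodule.comap_map_eq_of_injective LinearMap.inl_injective, ← Submodule.map_comp,
      LinearMap.snd_comp_inl, Submodule.map_zero, rank_bot, finrank_bot]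
    omega

/-- A space containing the whole first factor has rank-lack zero there, so again the `min` vanishes.
-/
theorem snd_of_freeProd (h : M.IsMinorEmbedding S T (N₁.freeProd N₂) f) :
    M.IsMinorEmbedding (S ⊔ LinearMap.range (f ∘ₗ LinearMap.inl K F₁ F₂)) T N₂
      (f ∘ₗ LinearMap.inr K F₁ F₂) where
  injective := h.injective.comp LinearMap.inr_injective
  inf_range := by
    rw [eq_bot_iff]
    rintro _ ⟨hx, b, rfl⟩
    obtain ⟨s, hs, _, ⟨a, rfl⟩, hab⟩ := Submodule.mem_sup.1 hx
    have h0 : f (-a, b) = s := by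
      rw [← eq_sub_iff_add_eq] at hab
      simp only [LinearMap.comp_apply, ← map_sub] at hab
      rw [hab]
      simp
    have h1 := h.eq_zero (h0 ▸ hs)
    rw [Prod.mk_eq_zero] at h1
    simp only [h1.2, map_zero]
    exact Submodule.zero_mem _
  sup_range := by
    rw [sup_assoc, ← LinearMap.range_coprod, ← LinearMap.comp_coprod, LinearMap.coprod_inl_inr,
      LinearMap.comp_id, h.sup_range]
  rank_sup_map X := by
    have e : S ⊔ LinearMap.range (f ∘ₗ LinearMap.inl K F₁ F₂) ⊔
        X.map (f ∘ₗ LinearMap.inr K F₁ F₂) = S ⊔ ((⊤ : Submodule K F₁).prod X).map f := by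
      rw [map_top_prod, sup_assoc]
    have e' : S ⊔ LinearMap.range (f ∘ₗ LinearMap.inl K F₁ F₂) =
        S ⊔ ((⊤ : Submodule K F₁).prod ⊥).map f := by
      rw [map_top_prod, Submodule.map_bot, sup_bot_eq]
    have c : ∀ X : Submodule K F₂,
        ((⊤ : Submodule K F₁).prod X).comap (LinearMap.inl K F₁ F₂) = ⊤ :=
      fun X => by ext; simp
    have s : ∀ X : Submodule K F₂,
        ((⊤ : Submodule K F₁).prod X).map (LinearMap.snd K F₁ F₂) = X :=
      fun X => by ext; simp
    rw [e, e', h.rank_sup_map, h.rank_sup_map]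
    simp only [QMatroid.freeProd, c, s, rank_bot]
    omega

/-- The `min` in the free product rank equals the rank-lack or the nullity; these cases are the two
alternatives of a free separator. -/
theorem isFreeSeparatorOn_of_freeProd [FiniteDimensional K E]
    (h : M.IsMinorEmbedding S T (N₁.freeProd N₂) f) :
    M.IsFreeSeparatorOn S T (S ⊔ LinearMap.range (f ∘ₗ LinearMap.inl K F₁ F₂)) := by
  intro X hSX hXT
  obtain ⟨Y, rfl⟩ : ∃ Y, S ⊔ Submodule.map f Y = X := ⟨_, h.sup_map_comap hSX hXT⟩
  have h₁ := h.fst_of_freeProd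
  have h₂ := h.snd_of_freeProd
  set A := S ⊔ LinearMap.range (f ∘ₗ LinearMap.inl K F₁ F₂) with hA
  have hf : f = (f ∘ₗ LinearMap.inl K F₁ F₂).coprod (f ∘ₗ LinearMap.inr K F₁ F₂) := by
    rw [← LinearMap.comp_coprod, LinearMap.coprod_inl_inr, LinearMap.comp_id]
  have e₁ := h₁.sup_map_coprod_inf h₂ Y
  have e₂ := h₁.sup_map_coprod_sup (g₂ := f ∘ₗ LinearMap.inr K F₁ F₂) Y
  rw [← hf] at e₁ e₂
  rw [e₁, e₂]
  have r := h.rank_sup_map Y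
  have r₁ := h₁.rank_sup_map (Y.comap (LinearMap.inl K F₁ F₂))
  have r₂ := h₂.rank_sup_map (Y.map (LinearMap.snd K F₁ F₂))
  have rA := h₁.rank_sup_map ⊤
  rw [h₁.sup_map_top] at rA
  have d := h.finrank_sup_map Y
  have d₁ := h₁.finrank_sup_map (Y.comap (LinearMap.inl K F₁ F₂))
  have dX := finrank_eq_comap_inl_add_map_snd Y
  have b₁ := N₁.rank_mono _ _ (le_top : Y.comap (LinearMap.inl K F₁ F₂) ≤ ⊤)
  have b₂ := N₂.rank_le_finrank (Y.map (LinearMap.snd K F₁ F₂))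
  simp only [QMatroid.freeProd] at r
  omega

end IsMinorEmbedding

theorem isMinorEmbedding_id (M : QMatroid K E) : M.IsMinorEmbedding ⊥ ⊤ M LinearMap.id where
  injective := Function.injective_id
  inf_range := bot_inf_eq _
  sup_range := by rw [LinearMap.range_id, bot_sup_eq]
  rank_sup_map X := by rw [Submodule.map_id, bot_sup_eq, rank_bot, add_zero]

/-- A linear section of `T → T / S` selects the complement of `S` in `T`. -/
theorem exists_isMinorEmbedding_minor [FiniteDimensional K E] (M : QMatroid K E) (hST : S ≤ T) :
    ∃ g, M.IsMinorEmbedding S T (M.minor S T) g := by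
  obtain ⟨s, hs⟩ := (S.submoduleOf T).mkQ.exists_rightInverse_of_surjective (Submodule.range_mkQ _)
  have hs' : ∀ q, (S.submoduleOf T).mkQ (s q) = q := fun q => LinearMap.congr_fun hs q
  have hmap : ∀ X : Submodule K (T ⧸ S.submoduleOf T),
      (X.comap (S.submoduleOf T).mkQ).map T.subtype = S ⊔ X.map (T.subtype ∘ₗ s) := by
    intro X
    apply le_antisymm
    · rintro _ ⟨y, hy, rfl⟩
      have h1 : (y - s ((S.submoduleOf T).mkQ y)) ∈ S.submoduleOf T := by
        apply (Submodule.Quotient.mk_eq_zero _).1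
        rw [← Submodule.mkQ_apply, map_sub, hs', sub_self]
      refine Submodule.mem_sup.2 ⟨_, h1, _, ⟨_, hy, rfl⟩, ?_⟩
      simp
    · refine sup_le (fun x hx => ⟨⟨x, hST hx⟩, ?_, rfl⟩) ?_
      · exact Submodule.le_comap_mkQ _ X hx
      · rintro _ ⟨q, hq, rfl⟩
        refine ⟨s q, ?_, rfl⟩
        change (S.submoduleOf T).mkQ (s q) ∈ X
        rwa [hs']
  have hS : (S.submoduleOf T).map T.subtype = S := by
    rw [Submodule.submoduleOf, Submodule.map_comap_subtype, inf_eq_right.2 hST]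
  have hker : ∀ q, T.subtype (s q) ∈ S → q = 0 := by
    intro q hq
    rw [← hs' q]
    exact (Submodule.Quotient.mk_eq_zero _).2 hq
  refine ⟨T.subtype ∘ₗ s, ?_, ?_, ?_, fun X => ?_⟩
  · refine (injective_iff_map_eq_zero _).2 fun q hq => hker q ?_
    rw [LinearMap.comp_apply] at hq
    rw [hq]
    exact S.zero_mem
  · rw [eq_bot_iff]
    rintro _ ⟨h, q, rfl⟩
    rw [hker q h, map_zero]
    exact Submodule.zero_mem _
  · rw [← Submodule.map_top, ← hmap, Submodule.comap_top, Submodule.map_top,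
      Submodule.range_subtype]
  · have h1 : (M.minor S T).rank X = M.rank (S ⊔ X.map (T.subtype ∘ₗ s)) - M.rank S := by
      rw [← hmap, minor, contract, restrict]
      simp only [hS]
    have h2 := M.rank_mono _ _ (le_sup_left : S ≤ S ⊔ X.map (T.subtype ∘ₗ s))
    omega

end MinorEmbeddings

end QMatroid

namespace QMatroid

/-! ### Chains of free separators and factorisations -/

section Factorisations

open BundledQMatroid

variable {K : Type v} {E : Type u} [Field K] [AddCommGroup E] [Module K E]
  [FiniteDimensional K E]

/-- The minor `M[S, T]`, bundled with its ground space `T / S`. -/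
def minorBundle (M : QMatroid K E) (S T : Submodule K E) : BundledQMatroid.{u} K where
  carrier := T ⧸ S.submoduleOf T
  toQMatroid := M.minor S T

/-- The `n` consecutive minors `M[tₐ, tₐ₊₁], …` of a sequence of subspaces, starting at `a`. -/
def chainMinors (M : QMatroid K E) (t : ℕ → Submodule K E) (a n : ℕ) :
    List (BundledQMatroid.{u} K) :=
  (List.range' a n).map fun i => M.minorBundle (t i) (t (i + 1))

variable {M : QMatroid K E} {S T : Submodule K E}

/-- A minor between free separators is irreducible if and only if there is no free separator in
the interior of its interval. -/
theorem IsMinorEmbedding.isIrreducible_iff {N : BundledQMatroid.{u} K} {g : N.carrier →ₗ[K] E}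
    (h : M.IsMinorEmbedding S T N.toQMatroid g) (hS : M.IsFreeSeparator S)
    (hT : M.IsFreeSeparator T) :
    N.IsIrreducible ↔ ∀ A, M.IsFreeSeparator A → S < A → ¬ A < T := by
  constructor
  · intro hN A hA hSA hAT
    obtain ⟨g₁, h₁⟩ := M.exists_isMinorEmbedding_minor hSA.le
    obtain ⟨g₂, h₂⟩ := M.exists_isMinorEmbedding_minor hAT.le
    exact hN (M.minorBundle S A) (M.minorBundle A T) (h₁.lt_iff_nontrivial.1 hSA)
      (h₂.lt_iff_nontrivial.1 hAT) (h.exists_isIsom (h₁.freeProd h₂ (hA.isFreeSeparatorOn S T)))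
  · rintro hN B C hB hC ⟨τ, hτ⟩
    have h' : M.IsMinorEmbedding S T (B.toQMatroid.freeProd C.toQMatroid) _ := h.of_isIsom hτ
    have hSA := h'.fst_of_freeProd.lt_iff_nontrivial.2 hB
    have hAT := h'.snd_of_freeProd.lt_iff_nontrivial.2 hC
    exact hN _ (h'.isFreeSeparatorOn_of_freeProd.isFreeSeparator hSA.le hAT.le hS hT) hSA hAT

/-- A chain of free separators exhibits a minor as the free product of the consecutive minors. -/
theorem exists_isMinorEmbedding_listProd {t : ℕ → Submodule K E} (ht : Monotone t)
    (hs : ∀ i, M.IsFreeSeparator (t i)) (n : ℕ) :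
    ∀ a, ∃ g, M.IsMinorEmbedding (t a) (t (a + n))
      (listProd (M.chainMinors t a n)).toQMatroid g := by
  induction n with
  | zero =>
    intro a
    refine ⟨0, fun x y _ => Subsingleton.elim (α := PUnit) x y, ?_, ?_, fun X => ?_⟩
    · rw [LinearMap.range_zero, inf_bot_eq]
    · rw [LinearMap.range_zero, sup_bot_eq, add_zero]
    · rw [Submodule.map_zero, sup_bot_eq]
      exact (Nat.zero_add _).symm
  | succ n ih =>
    intro a
    obtain ⟨g₁, h₁⟩ := M.exists_isMinorEmbedding_minor (ht (Nat.le_succ a))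
    -- A one-term `listProd` is the factor itself, not its product with `zero`.
    rcases n with - | n
    · exact ⟨g₁, h₁⟩
    · obtain ⟨g₂, h₂⟩ := ih (a + 1)
      have e : a + 1 + (n + 1) = a + (n + 1 + 1) := by omega
      rw [e] at h₂
      exact ⟨_, h₁.freeProd h₂ ((hs (a + 1)).isFreeSeparatorOn _ _)⟩

theorem initialSpace_zero (L : List (BundledQMatroid.{u} K)) : initialSpace L 0 = ⊥ := by
  rcases L with - | ⟨A, - | ⟨B, L⟩⟩ <;> rfl

/-- The initial spaces of a free product of a sequence are free separators, and the minors between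
them are the factors. -/
theorem IsMinorEmbedding.initialSpace_listProd (L : List (BundledQMatroid.{u} K)) :
    ∀ {S T : Submodule K E} {g : (listProd L).carrier →ₗ[K] E},
      M.IsMinorEmbedding S T (listProd L).toQMatroid g → M.IsFreeSeparator S →
      M.IsFreeSeparator T → S ⊔ (initialSpace L L.length).map g = T ∧
      (∀ i ≤ L.length, M.IsFreeSeparator (S ⊔ (initialSpace L i).map g)) ∧
      ∀ i (hi : i < L.length), ∃ g' : L[i].carrier →ₗ[K] E,
        M.IsMinorEmbedding (S ⊔ (initialSpace L i).map g)
          (S ⊔ (initialSpace L (i + 1)).map g) L[i].toQMatroid g' := by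
  induction L with
  | nil =>
    intro S T g h hS hT
    have hg : (⊤ : Submodule K (listProd ([] : List (BundledQMatroid.{u} K))).carrier) = ⊥ :=
      Subsingleton.elim (α := Submodule K PUnit.{u + 1}) _ _
    refine ⟨?_, fun i _ => ?_, fun i hi => absurd hi (Nat.not_lt_zero i)⟩
    · rw [← h.sup_map_top, hg]
      rfl
    · have : initialSpace ([] : List (BundledQMatroid.{u} K)) i = ⊥ := rfl
      rwa [this, Submodule.map_bot, sup_bot_eq]
  | cons A L ih =>
    intro S T g h hS hT
    rcases L with - | ⟨B, L⟩
    · have e₀ : S ⊔ (initialSpace [A] 0).map g = S := by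
        rw [initialSpace_zero, Submodule.map_bot, sup_bot_eq]
      have e₁ : S ⊔ (initialSpace [A] 1).map g = T := h.sup_map_top
      refine ⟨e₁, fun i hi => ?_, fun i hi => ?_⟩
      · obtain rfl | rfl : i = 0 ∨ i = 1 := by
          rw [List.length_singleton] at hi
          omega
        · rwa [e₀]
        · rwa [e₁]
      · obtain rfl : i = 0 := by
          rw [List.length_singleton] at hi
          omega
        rw [e₀, e₁]
        exact ⟨g, h⟩
    · have h' : M.IsMinorEmbedding S T
          (A.toQMatroid.freeProd (listProd (B :: L)).toQMatroid) g := h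
      have h₁ := h'.fst_of_freeProd
      have h₂ := h'.snd_of_freeProd
      -- The tail of the sequence lives in the interval from this separator to `T`, to which the
      -- induction hypothesis applies.
      have hR := h'.isFreeSeparatorOn_of_freeProd.isFreeSeparator h₁.le h₂.le hS hT
      obtain ⟨ih₁, ih₂, ih₃⟩ := ih h₂ hR hT
      have e₀ : S ⊔ (initialSpace (A :: B :: L) 0).map g = S := by
        rw [initialSpace_zero, Submodule.map_bot, sup_bot_eq]
      have e : ∀ i, S ⊔ (initialSpace (A :: B :: L) (i + 1)).map g =
          S ⊔ LinearMap.range (g ∘ₗ LinearMap.inl K A.carrier (listProd (B :: L)).carrier) ⊔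
            (initialSpace (B :: L) i).map
              (g ∘ₗ LinearMap.inr K A.carrier (listProd (B :: L)).carrier) := fun i => by
        rw [sup_assoc]
        exact congrArg (S ⊔ ·) (map_top_prod g (initialSpace (B :: L) i))
      refine ⟨(e _).trans ih₁, fun i hi => ?_, fun i hi => ?_⟩
      · rcases i with - | i
        · rwa [e₀]
        · rw [e]
          exact ih₂ i (Nat.le_of_succ_le_succ hi)
      · rcases i with - | i
        · rw [e₀, e, initialSpace_zero, Submodule.map_bot, sup_bot_eq]
          exact ⟨_, h₁⟩
        · rw [e, e]
          exact ih₃ i (Nat.lt_of_succ_lt_succ hi)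

/-- A chain of free separators from `0` to `E` whose consecutive minors are nontrivial and uniform
or irreducible, and such that no two consecutive minors combine to a uniform one, consists of the
pinchpoints. -/
theorem mem_chain_iff_isPinchpoint {t : ℕ → Submodule K E} {n : ℕ} (h0 : t 0 = ⊥) (hn : t n = ⊤)
    (hs : ∀ i ≤ n, M.IsFreeSeparator (t i)) (hlt : ∀ i < n, t i < t (i + 1))
    (hui : ∀ i < n, M.IsUniformOn (t i) (t (i + 1)) ∨
      ∀ A, M.IsFreeSeparator A → t i < A → ¬ A < t (i + 1))
    (hnu : ∀ i, i + 1 < n → ¬ M.IsUniformOn (t i) (t (i + 2))) (X : Submodule K E) :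
    (∃ i ≤ n, t i = X) ↔ IsPinchpoint M.latticeD X := by
  have hint : ∀ i < n, ∀ A, IsPinchpoint M.latticeD A → t i < A → ¬ A < t (i + 1) := by
    intro i hi A hA h1 h2
    rw [isPinchpoint_iff] at hA
    rcases hui i hi with h | h
    · exact (hs i hi.le).not_isUniformOn (hs (i + 1) hi) hA.1 h1 h2 h
    · exact h A hA.2 h1 h2
  -- Otherwise `t i` lies inside a uniform interval between pinchpoints `P` and `Q`. By `hint` this
  -- contains the interval from the predecessor of `t i` to its successor, contradicting `hnu`.
  have hmem : ∀ i ≤ n, t i ∈ M.latticeD := by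
    intro i hi
    by_contra hD
    obtain ⟨P, Q, hP, hQ, hPt, htQ, hU⟩ := (hs i hi).exists_isUniformOn hD
    rcases i with - | i
    · exact hD (h0 ▸ bot_mem_latticeD)
    · rcases Nat.eq_or_lt_of_le hi with rfl | hi'
      · exact hD (hn ▸ top_mem_latticeD)
      · refine hnu i hi' (hU.mono ?_ ?_)
        · refine ((hs i (by omega)).comparable_latticeD hP.1).elim (fun h => ?_) id
          by_contra hne
          exact hint i (by omega) P hP (lt_of_le_not_ge h hne) hPt
        · refine ((hs (i + 2) hi').comparable_latticeD hQ.1).elim id (fun h => ?_)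
          by_contra hne
          exact hint (i + 1) hi' Q hQ htQ (lt_of_le_not_ge h hne)
  constructor
  · rintro ⟨i, hi, rfl⟩
    exact isPinchpoint_iff.2 ⟨hmem i hi, hs i hi⟩
  · intro hX
    by_contra! hno
    -- A pinchpoint outside the chain climbs past every `t i`, including `t n = ⊤`.
    have hle : ∀ i ≤ n, t i < X := by
      intro i
      induction i with
      | zero => exact fun hi => lt_of_le_of_ne (h0 ▸ bot_le) (hno 0 hi)
      | succ i ih =>
        intro hi
        refine lt_of_le_of_ne ?_ (hno _ hi)
        refine ((hs (i + 1) hi).comparable_latticeD hX.1).elim id fun h => ?_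
        exact absurd (lt_of_le_of_ne h (hno _ hi).symm) (hint i hi X hX (ih (by omega)))
    exact (hle n le_rfl).not_ge (hn ▸ le_top)

/-- The pinchpoints form a finite chain. -/
theorem exists_isPrimaryFlag (M : QMatroid K E) :
    ∃ (k : ℕ) (T : Fin (k + 1) → Submodule K E), M.IsPrimaryFlag T := by
  set P := {X | IsPinchpoint M.latticeD X} with hP
  -- Comparable spaces of equal dimension coincide, so the pinchpoints are enumerated by their
  -- finite set of dimensions.
  have hfin : ((fun X : Submodule K E => Module.finrank K X) '' P).Finite := by
    refine (Set.finite_Iic (Module.finrank K E)).subset ?_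
    rintro _ ⟨X, -, rfl⟩
    exact Submodule.finrank_le X
  obtain ⟨k, hk⟩ : ∃ k, hfin.toFinset.card = k + 1 := by
    refine Nat.exists_eq_succ_of_ne_zero (Finset.card_ne_zero_of_mem (a := Module.finrank K
      (⊥ : Submodule K E)) ?_)
    rw [Set.Finite.mem_toFinset]
    exact ⟨⊥, isPinchpoint_iff.2 ⟨bot_mem_latticeD, isFreeSeparator_bot⟩, rfl⟩
  have hmem : ∀ i, ∃ X ∈ P, Module.finrank K X = hfin.toFinset.orderEmbOfFin hk i := fun i => by
    have := Finset.orderEmbOfFin_mem hfin.toFinset hk i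
    rwa [Set.Finite.mem_toFinset] at this
  choose T hTP hTd using hmem
  refine ⟨k, T, fun i j hij => ?_, Set.Subset.antisymm ?_ fun X hX => ?_⟩
  · have hd : Module.finrank K (T i) < Module.finrank K (T j) := by
      rw [hTd, hTd]
      exact (hfin.toFinset.orderEmbOfFin hk).strictMono hij
    refine lt_of_le_of_ne (((hTP i).2 _ (hTP j).1).elim id fun h => ?_) fun h => ?_
    · exact absurd (Submodule.finrank_mono h) hd.not_ge
    · rw [h] at hd
      exact hd.false
  · rintro _ ⟨i, rfl⟩
    exact hTP i
  · have h1 : Module.finrank K X ∈ Set.range (hfin.toFinset.orderEmbOfFin hk) := by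
      rw [Finset.range_orderEmbOfFin, Set.Finite.coe_toFinset]
      exact ⟨X, hX, rfl⟩
    obtain ⟨i, hi⟩ := h1
    refine ⟨i, ?_⟩
    have hd : Module.finrank K (T i) = Module.finrank K X := (hTd i).trans hi
    rcases (hTP i).2 X hX.1 with h | h
    · exact Submodule.eq_of_le_of_finrank_eq h hd
    · exact (Submodule.eq_of_le_of_finrank_eq h hd.symm).symm

end Factorisations

end QMatroid

namespace QMatroid

/-! ### The primary flag: existence and uniqueness of the factorisation -/

section PrimaryFlag

open BundledQMatroid

variable {K : Type v} {E : Type u} [Field K] [AddCommGroup E] [Module K E] {M : QMatroid K E}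

/-- A flag `T₀, …, Tₖ` as an eventually constant sequence. -/
def flagSeq {k : ℕ} (T : Fin (k + 1) → Submodule K E) (i : ℕ) : Submodule K E :=
  T ⟨min i k, by omega⟩

theorem flagSeq_of_le {k : ℕ} (T : Fin (k + 1) → Submodule K E) {i : ℕ} (hi : i ≤ k) :
    flagSeq T i = T ⟨i, by omega⟩ := congrArg T (Fin.ext (min_eq_left hi))

namespace IsPrimaryFlag

variable {k : ℕ} {T : Fin (k + 1) → Submodule K E}

theorem isPinchpoint (hT : M.IsPrimaryFlag T) (i : ℕ) :
    IsPinchpoint M.latticeD (flagSeq T i) := by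
  have h : flagSeq T i ∈ Set.range T := ⟨_, rfl⟩
  rwa [hT.2] at h

theorem monotone_flagSeq (hT : M.IsPrimaryFlag T) : Monotone (flagSeq T) := fun _ _ hij =>
  hT.1.monotone (Fin.mk_le_mk.2 (min_le_min_right k hij))

theorem flagSeq_lt (hT : M.IsPrimaryFlag T) {i j : ℕ} (hij : i < j) (hj : j ≤ k) :
    flagSeq T i < flagSeq T j := by
  rw [flagSeq_of_le T hj, flagSeq_of_le T (hij.le.trans hj)]
  exact hT.1 (Fin.mk_lt_mk.2 hij)

theorem not_isPinchpoint_between (hT : M.IsPrimaryFlag T) {i : ℕ} (hi : i < k)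
    {X : Submodule K E} (h₁ : flagSeq T i < X) (h₂ : X < flagSeq T (i + 1)) :
    ¬ IsPinchpoint M.latticeD X := by
  intro hX
  obtain ⟨j, rfl⟩ : X ∈ Set.range T := hT.2 ▸ hX
  rw [flagSeq_of_le T hi.le, hT.1.lt_iff_lt] at h₁
  rw [flagSeq_of_le T hi, hT.1.lt_iff_lt] at h₂
  rw [Fin.lt_def] at h₁ h₂
  simp only at h₁ h₂
  omega

end IsPrimaryFlag

variable [FiniteDimensional K E]

theorem flagMinors_eq_chainMinors {k : ℕ} (T : Fin (k + 1) → Submodule K E) :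
    M.flagMinors T = M.chainMinors (flagSeq T) 0 k := by
  refine List.ext_getElem (by simp [flagMinors, chainMinors]) fun i h₁ h₂ => ?_
  have hi : i < k := by simpa [flagMinors] using h₁
  have e₁ : T (Fin.castSucc ⟨i, hi⟩) = flagSeq T i :=
    congrArg T (Fin.ext (min_eq_left hi.le).symm)
  have e₂ : T (Fin.succ ⟨i, hi⟩) = flagSeq T (i + 1) :=
    congrArg T (Fin.ext (min_eq_left hi).symm)
  have e : (M.flagMinors T)[i] =
      M.minorBundle (T (Fin.castSucc ⟨i, hi⟩)) (T (Fin.succ ⟨i, hi⟩)) := by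
    simp only [flagMinors, List.getElem_ofFn]
    rfl
  rw [e, e₁, e₂]
  simp [chainMinors]

theorem eq_chainMinors_of_infix {t : ℕ → Submodule K E} {k : ℕ} {R : List (BundledQMatroid.{u} K)}
    (h : R <:+: M.chainMinors t 0 k) :
    ∃ a, a + R.length ≤ k ∧ R = M.chainMinors t a R.length := by
  obtain ⟨a, ha, hR⟩ := List.infix_iff_getElem?.1 h
  refine ⟨a, by simpa [chainMinors, add_comm] using ha,
    List.ext_getElem (by simp [chainMinors]) fun i h₁ h₂ => ?_⟩
  have hlt : i + a < k := by
    simp only [chainMinors, List.length_map, List.length_range'] at ha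
    omega
  have := hR i h₁
  simp only [chainMinors, List.getElem?_map, List.getElem?_range' hlt, Option.map_some,
    Option.some.injEq] at this
  rw [← this]
  simp [chainMinors, add_comm]

namespace IsPrimaryFlag

variable {k : ℕ} {T : Fin (k + 1) → Submodule K E}

theorem isFreeSeparator (hT : M.IsPrimaryFlag T) (i : ℕ) : M.IsFreeSeparator (flagSeq T i) :=
  (isPinchpoint_iff.1 (hT.isPinchpoint i)).2

theorem flagSeq_zero (hT : M.IsPrimaryFlag T) : flagSeq T 0 = ⊥ := by
  have h : ⊥ ∈ Set.range T :=
    hT.2 ▸ isPinchpoint_iff.2 ⟨bot_mem_latticeD, isFreeSeparator_bot⟩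
  obtain ⟨i, hi⟩ := h
  rw [eq_bot_iff, ← hi]
  exact hT.1.monotone (Fin.mk_le_mk.2 (by simp))

theorem flagSeq_last (hT : M.IsPrimaryFlag T) : flagSeq T k = ⊤ := by
  have h : ⊤ ∈ Set.range T :=
    hT.2 ▸ isPinchpoint_iff.2 ⟨top_mem_latticeD, isFreeSeparator_top⟩
  obtain ⟨i, hi⟩ := h
  rw [eq_top_iff, ← hi]
  exact hT.1.monotone (Fin.mk_le_mk.2 (by rw [min_self]; exact Nat.le_of_lt_succ i.2))

/-- A free separator strictly between consecutive pinchpoints is outside D(M), so it lies in a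
uniform interval bounded by pinchpoints; that interval must contain the whole gap. -/
theorem isUniformOn_or (hT : M.IsPrimaryFlag T) {i : ℕ} (hi : i < k) :
    M.IsUniformOn (flagSeq T i) (flagSeq T (i + 1)) ∨
      ∀ A, M.IsFreeSeparator A → flagSeq T i < A → ¬ A < flagSeq T (i + 1) := by
  by_contra! hcon
  obtain ⟨hnu, A, hA, h₁, h₂⟩ := hcon
  have hAD : A ∉ M.latticeD := fun h =>
    hT.not_isPinchpoint_between hi h₁ h₂ (isPinchpoint_iff.2 ⟨h, hA⟩)
  obtain ⟨P, Q, hP, hQ, hPA, hAQ, hU⟩ := hA.exists_isUniformOn hAD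
  refine hnu (hU.mono ?_ ?_)
  · refine ((hT.isPinchpoint i).2 P hP.1).elim (fun h => ?_) id
    by_contra hne
    exact hT.not_isPinchpoint_between hi (lt_of_le_not_ge h hne) (hPA.trans h₂) hP
  · refine ((hT.isPinchpoint (i + 1)).2 Q hQ.1).elim id (fun h => ?_)
    by_contra hne
    exact hT.not_isPinchpoint_between hi (h₁.trans hAQ) (lt_of_le_not_ge h hne) hQ

theorem exists_isIsom_listProd (hT : M.IsPrimaryFlag T) :
    ∃ φ : E ≃ₗ[K] (listProd (M.flagMinors T)).carrier,
      M.IsIsom (listProd (M.flagMinors T)).toQMatroid φ := by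
  rw [flagMinors_eq_chainMinors]
  obtain ⟨g, h⟩ := exists_isMinorEmbedding_listProd hT.monotone_flagSeq hT.isFreeSeparator k 0
  rw [zero_add, hT.flagSeq_zero, hT.flagSeq_last] at h
  exact M.isMinorEmbedding_id.exists_isIsom h

theorem isUniform_or_isIrreducible (hT : M.IsPrimaryFlag T) {A : BundledQMatroid.{u} K}
    (hA : A ∈ M.flagMinors T) :
    Nontrivial A.carrier ∧ (A.toQMatroid.IsUniform ∨ A.IsIrreducible) := by
  rw [flagMinors_eq_chainMinors, chainMinors, List.mem_map] at hA
  obtain ⟨i, hi, rfl⟩ := hA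
  have hik : i < k := by simpa using hi
  have hlt := hT.flagSeq_lt (Nat.lt_succ_self i) hik
  obtain ⟨g, h⟩ := M.exists_isMinorEmbedding_minor hlt.le
  exact ⟨h.lt_iff_nontrivial.1 hlt, (hT.isUniformOn_or hik).imp h.isUniform_iff.2
    (IsMinorEmbedding.isIrreducible_iff (N := M.minorBundle (flagSeq T i) (flagSeq T (i + 1))) h
      (hT.isFreeSeparator i) (hT.isFreeSeparator (i + 1))).2⟩

/-- Two or more consecutive factors span an interval with a pinchpoint in its interior. -/
theorem not_isUniform_listProd (hT : M.IsPrimaryFlag T) {R : List (BundledQMatroid.{u} K)}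
    (hR : R <:+: M.flagMinors T) (h2 : 2 ≤ R.length) :
    ¬ (listProd R).toQMatroid.IsUniform := by
  rw [flagMinors_eq_chainMinors] at hR
  obtain ⟨a, ha, hRa⟩ := eq_chainMinors_of_infix hR
  have hex := exists_isMinorEmbedding_listProd hT.monotone_flagSeq hT.isFreeSeparator R.length a
  rw [← hRa] at hex
  obtain ⟨g, h⟩ := hex
  rw [h.isUniform_iff]
  exact (hT.isFreeSeparator a).not_isUniformOn (hT.isFreeSeparator _) (hT.isPinchpoint (a + 1)).1
    (hT.flagSeq_lt (by omega) (by omega)) (hT.flagSeq_lt (by omega) ha)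

/-- The initial spaces pulled back along `φ` form a strict chain with the pinchpoints as its
members. Strictly increasing enumerations of one set agree, and corresponding factors realise the
same minor of `M`. -/
theorem unique_factorisation (hT : M.IsPrimaryFlag T) (L : List (BundledQMatroid.{u} K))
    (φ : E ≃ₗ[K] (listProd L).carrier) (hφ : M.IsIsom (listProd L).toQMatroid φ)
    (hL : ∀ A ∈ L, Nontrivial A.carrier ∧ (A.toQMatroid.IsUniform ∨ A.IsIrreducible))
    (hc : L.IsChain (fun A B => ¬ (A.freeProd B).toQMatroid.IsUniform)) :
    L.length = k ∧ (∀ i : Fin (k + 1), (T i).map φ.toLinearMap = initialSpace L (i : ℕ)) ∧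
      List.Forall₂ Iso L (M.flagMinors T) := by
  obtain ⟨hlast, hs, hemb⟩ := (M.isMinorEmbedding_id.of_isIsom hφ).initialSpace_listProd L isFreeSeparator_bot
    isFreeSeparator_top
  simp only [LinearMap.id_comp, bot_sup_eq] at hlast hs hemb
  set t : ℕ → Submodule K E := fun i => (initialSpace L i).map φ.symm.toLinearMap with ht
  have hlt : ∀ i < L.length, t i < t (i + 1) := fun i hi => by
    obtain ⟨g, h⟩ := hemb i hi
    exact h.lt_iff_nontrivial.2 (hL _ (List.getElem_mem hi)).1
  have hiff := mem_chain_iff_isPinchpoint (M := M) (t := t) (n := L.length)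
    (by rw [ht]; simp only [initialSpace_zero, Submodule.map_bot]) hlast hs hlt
    (fun i hi => by
      obtain ⟨g, h⟩ := hemb i hi
      exact (hL _ (List.getElem_mem hi)).2.imp h.isUniform_iff.1
        (h.isIrreducible_iff (hs i hi.le) (hs (i + 1) hi)).1)
    (fun i hi => by
      obtain ⟨g₁, h₁⟩ := hemb i (by omega)
      obtain ⟨g₂, h₂⟩ := hemb (i + 1) hi
      -- The product of two adjacent factors realises the minor from `t i` to `t (i + 2)`.
      rw [← (h₁.freeProd h₂ ((hs (i + 1) hi.le).isFreeSeparatorOn _ _)).isUniform_iff]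
      exact List.isChain_iff_getElem.1 hc i hi)
  set U : Fin (L.length + 1) → Submodule K E := fun i => t i with hU
  have hUmono : StrictMono U := Fin.strictMono_iff_lt_succ.2 fun i => hlt i i.2
  have hrange : Set.range U = Set.range T := by
    rw [hT.2]
    ext X
    rw [Set.mem_ofPred_eq, ← hiff X]
    constructor
    · rintro ⟨i, rfl⟩
      exact ⟨i, Nat.le_of_lt_succ i.2, rfl⟩
    · rintro ⟨i, hi, rfl⟩
      exact ⟨⟨i, Nat.lt_succ_of_le hi⟩, rfl⟩
  have hk : L.length = k := by
    have h := congrArg Set.ncard hrange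
    rw [← Set.image_univ, ← Set.image_univ, Set.ncard_image_of_injective _ hUmono.injective,
      Set.ncard_image_of_injective _ hT.1.injective, Set.ncard_univ, Set.ncard_univ,
      Nat.card_fin, Nat.card_fin] at h
    omega
  subst hk
  have hUT : U = T := (hUmono.range_inj hT.1).1 hrange
  have htT : ∀ i ≤ L.length, flagSeq T i = t i := fun i hi => by
    rw [flagSeq_of_le T hi, ← hUT]
  refine ⟨rfl, fun i => ?_, ?_⟩
  · rw [← hUT]
    change Submodule.map _ (Submodule.map _ _) = _
    rw [← Submodule.map_comp, LinearEquiv.comp_symm, Submodule.map_id]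
  · rw [flagMinors_eq_chainMinors, List.forall₂_iff_get]
    refine ⟨by simp [chainMinors], fun i h₁ h₂ => ?_⟩
    obtain ⟨g, h⟩ := hemb i h₁
    have e : (M.chainMinors (flagSeq T) 0 L.length).get ⟨i, h₂⟩ =
        M.minorBundle (t i) (t (i + 1)) := by
      simp [chainMinors, htT i h₁.le, htT (i + 1) h₁]
    rw [e]
    obtain ⟨g', h'⟩ := M.exists_isMinorEmbedding_minor (hlt i h₁).le
    exact h.exists_isIsom h'

end IsPrimaryFlag

end PrimaryFlag

end QMatroid

theorem mainTheorem6 {K : Type v} [Field K] [Finite K] {E : Type u} [AddCommGroup E] [Module K E]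
    [FiniteDimensional K E] (M : QMatroid K E) :
    ∃ (k : ℕ) (T : Fin (k + 1) → Submodule K E), M.IsPrimaryFlag T ∧
      -- `M` is the free product of its primary factors
      (∃ φ : E ≃ₗ[K] (BundledQMatroid.listProd (M.flagMinors T)).carrier,
        M.IsIsom (BundledQMatroid.listProd (M.flagMinors T)).toQMatroid φ) ∧
      -- the primary factors are nontrivial, and each is uniform or irreducible
      (∀ A ∈ M.flagMinors T, Nontrivial A.carrier ∧
        (A.toQMatroid.IsUniform ∨ A.IsIrreducible)) ∧
      -- no free product of two or more consecutive primary factors is uniform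
      (∀ R : List (BundledQMatroid.{u} K), R <:+: M.flagMinors T → 2 ≤ R.length →
        ¬ (BundledQMatroid.listProd R).toQMatroid.IsUniform) ∧
      -- every factorisation with these properties has the primary flag as its flag and the
      -- primary factors as its factors
      (∀ (L : List (BundledQMatroid.{u} K)) (φ : E ≃ₗ[K] (BundledQMatroid.listProd L).carrier),
        M.IsIsom (BundledQMatroid.listProd L).toQMatroid φ →
        (∀ A ∈ L, Nontrivial A.carrier ∧ (A.toQMatroid.IsUniform ∨ A.IsIrreducible)) →
        L.IsChain (fun A B => ¬ (A.freeProd B).toQMatroid.IsUniform) →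
        L.length = k ∧
          (∀ i : Fin (k + 1),
            (T i).map φ.toLinearMap = BundledQMatroid.initialSpace L (i : ℕ)) ∧
          List.Forall₂ BundledQMatroid.Iso L (M.flagMinors T)) := by
  obtain ⟨k, T, hT⟩ := M.exists_isPrimaryFlag
  exact ⟨k, T, hT, hT.exists_isIsom_listProd, fun _ hA => hT.isUniform_or_isIrreducible hA,
    fun _ hR h2 => hT.not_isUniform_listProd hR h2, hT.unique_factorisation⟩
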